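/- Let $n\ge 1$ and $1<q<\infty$. For a measurable complex-valued or $[0,\infty]$-valued function $g$ on $\mathbb R^n$ let $$Mg(x)=\sup_{P\ni x}\frac1{|P|}\int_P|g(y)|\,dy\in[0,\infty],$$ where the supremum is over all cubes $P\subset\mathbb R^n$ with sides parallel to the axes that contain $x$. For a sequence $f=\{f_j\}_{j=1}^\infty$ of measurable functions $f_j:\mathbb R^n\to\mathbb C$ put $$|f(x)|_q=\Big(\sum_{j=1}^\infty|f_j(x)|^q\Big)^{1/q},\qquad \overline M_qf(x)=\Big(\sum_{j=1}^\infty (Mf_j(x))^q\Big)^{1/q},$$ both with values in $[0,\infty]$. Then there are constants $\alpha,c>0$, depending only on $n$ and $q$, such that for every cube $Q\subset\mathbb R^n$ with sides parallel to the axes, every such sequence $f$ with $\operatorname{supp} f_j\subseteq Q$ for all $j$, and every $t>0$, $$|\{x\in Q:\ \overline M_qf(x)>t\,M(|f|_q)(x)\}|\le c\,e^{-\alpha t^q}\,|Q|.$$ -/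

import Mathlib

open MeasureTheory
open scoped ENNReal

noncomputable section

namespace HardyLittlewood

/-- Cubes of `ℝⁿ`: closed, with sides parallel to the axes and positive side length `l`.
(Using open or half-open cubes instead changes neither the maximal function below, at any point,
nor the measure of a cube.) -/
def IsCube {n : ℕ} (Q : Set (Fin n → ℝ)) : Prop :=
  ∃ (a : Fin n → ℝ) (l : ℝ), 0 < l ∧ Q = Set.Icc a (fun i => a i + l)

/-- The (non-centred) Hardy–Littlewood maximal function
`Mf(x) = sup_{Q ∋ x} |Q|⁻¹ ∫_Q |f(y)| dy`, the supremum being over all cubes `Q` containing `x`.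
It is `[0,∞]`-valued. It applies to `ℂ`-valued functions and also to
`[0,∞]`-valued ones, for which `‖f y‖ₑ = f y`. -/
def maximal {n : ℕ} {ε : Type*} [ENorm ε] (f : (Fin n → ℝ) → ε) (x : Fin n → ℝ) : ℝ≥0∞ :=
  ⨆ (Q : Set (Fin n → ℝ)) (_ : IsCube Q) (_ : x ∈ Q), (∫⁻ y in Q, ‖f y‖ₑ) / volume Q

/-- The pointwise `ℓ^q` norm `|f(x)|_q = (∑_j |f_j(x)|^q)^{1/q}`, with value `∞` where the
series diverges. -/
def lqNorm {n : ℕ} {ε : Type*} [ENorm ε] (q : ℝ) (f : ℕ → (Fin n → ℝ) → ε)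
    (x : Fin n → ℝ) : ℝ≥0∞ :=
  (∑' j, ‖f j x‖ₑ ^ q) ^ (1 / q)

/-- The vector-valued maximal operator
`M̄_q f(x) = (∑_j (M f_j(x))^q)^{1/q}`. -/
def vectorMaximal {n : ℕ} {ε : Type*} [ENorm ε] (q : ℝ) (f : ℕ → (Fin n → ℝ) → ε)
    (x : Fin n → ℝ) : ℝ≥0∞ :=
  (∑' j, maximal (f j) x ^ q) ^ (1 / q)

end HardyLittlewood

end

open MeasureTheory
open scoped ENNReal

noncomputable section

namespace HardyLittlewood

/-! The core is dyadic. For a grid, let F_k be the sum over j of the q-th powers of the maximal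
functions of |f_j| over cells of level at least k, and let H = M(|f|_q), which majorizes all dyadic
averages of |f|_q.

Half estimate (`measure_lt_vecMaxFrom_le_half`): if |f|_q has average a on a cell P of level k, then
F_k > Λ a^q on at most half of P. Averages of |f|_q exceed 4a only on a quarter of P. Elsewhere each
f_j may be replaced by its averages over Calderón–Zygmund stopping cells; by Minkowski the ℓ^q norm
of these is at most a multiple of a, so the scalar strong (q,q) inequality, summed over j, and
Chebyshev's inequality apply.

Iteration (`measure_lt_vecMaxFrom_le`): stop at the first level where the part of F_k seen so far
exceeds Λ a^q. The stopping cells fill at most half of P, and what was accumulated before stopping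
is at most Λ a^q ≤ Λ H^q. Hence each further multiple of Λ H^q halves the measure, and F_k > m Λ H^q
on at most 2^{-m}|P|. Levels add up in q-th powers, so m is of order t^q.

Transfer to cubes (`exists_maximal_le`): by the one-third trick, 2^n translated grids control M on Q
up to the factor 6^n. -/

/-- The points at which the sequence `p k, p (k + 1), …` of sets is first entered at index `i`. -/
def firstHit {X : Type*} (p : ℕ → Set X) (k i : ℕ) : Set X :=
  {x | k ≤ i ∧ x ∈ p i ∧ ∀ l, k ≤ l → l < i → x ∉ p l}

lemma pairwise_disjoint_firstHit {X : Type*} (p : ℕ → Set X) (k : ℕ) :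
    Pairwise (Function.onFun Disjoint (firstHit p k)) := by
  intro i j hij
  refine Set.disjoint_left.2 fun x hi hj => ?_
  rcases lt_or_gt_of_ne hij with h | h
  · exact hj.2.2 i hi.1 h hi.2.1
  · exact hi.2.2 j hj.1 h hj.2.1

lemma exists_mem_firstHit {X : Type*} {p : ℕ → Set X} {k i : ℕ} {x : X} (hki : k ≤ i) (hx : x ∈ p i) :
    ∃ j ≤ i, x ∈ firstHit p k j := by
  classical
  have h : ∃ j, k ≤ j ∧ x ∈ p j := ⟨i, hki, hx⟩
  exact ⟨Nat.find h, Nat.find_min' h ⟨hki, hx⟩, (Nat.find_spec h).1, (Nat.find_spec h).2,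
    fun l hkl hl hxl => Nat.find_min h hl ⟨hkl, hxl⟩⟩

/-! ### Nested partitions, averages, weak type (1,1) -/

/-- A decreasing sequence of countable measurable partitions into sets of positive finite measure,
each piece having measure at most `D` times that of any of its children. -/
structure NestedPartition {X : Type*} [MeasurableSpace X] (μ : Measure X) (D : ℝ≥0∞) where
  cell : ℕ → X → Set X
  mem_cell : ∀ k x, x ∈ cell k x
  cell_eq : ∀ {k x y}, y ∈ cell k x → cell k y = cell k x
  cell_succ_subset : ∀ k x, cell (k + 1) x ⊆ cell k x
  measurableSet_cell : ∀ k x, MeasurableSet (cell k x)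
  countable_range_cell : ∀ k, (Set.range (cell k)).Countable
  measure_cell_ne_zero : ∀ k x, μ (cell k x) ≠ 0
  measure_cell_ne_top : ∀ k x, μ (cell k x) ≠ ∞
  measure_cell_le : ∀ k x, μ (cell k x) ≤ D * μ (cell (k + 1) x)

namespace NestedPartition

variable {X : Type*} [MeasurableSpace X] {μ : Measure X} {D : ℝ≥0∞} (𝒢 : NestedPartition μ D)

lemma cell_anti (x : X) : Antitone fun k => 𝒢.cell k x :=
  antitone_nat_of_succ_le fun k => 𝒢.cell_succ_subset k x

lemma mem_cell_symm {k : ℕ} {x y : X} (h : y ∈ 𝒢.cell k x) : x ∈ 𝒢.cell k y := by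
  rw [𝒢.cell_eq h]; exact 𝒢.mem_cell k x

/-- A set is saturated at level `k` if it is a union of cells of level `k`. -/
def Saturated (k : ℕ) (S : Set X) : Prop := ∀ ⦃x y⦄, y ∈ 𝒢.cell k x → x ∈ S → y ∈ S

variable {𝒢}

lemma Saturated.mono {k l : ℕ} {S : Set X} (h : 𝒢.Saturated k S) (hkl : k ≤ l) :
    𝒢.Saturated l S := fun x _ hy hx => h (𝒢.cell_anti x hkl hy) hx

lemma Saturated.inter {k : ℕ} {S T : Set X} (hS : 𝒢.Saturated k S) (hT : 𝒢.Saturated k T) :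
    𝒢.Saturated k (S ∩ T) := fun _ _ hy hx => ⟨hS hy hx.1, hT hy hx.2⟩

lemma Saturated.compl {k : ℕ} {S : Set X} (hS : 𝒢.Saturated k S) : 𝒢.Saturated k Sᶜ :=
  fun _ _ hy hx hyS => hx (hS (𝒢.mem_cell_symm hy) hyS)

lemma Saturated.eq_biUnion {k : ℕ} {S : Set X} (hS : 𝒢.Saturated k S) :
    S = ⋃ C ∈ {C ∈ Set.range (𝒢.cell k) | C ⊆ S}, C := by
  ext x
  simp only [Set.mem_iUnion, Set.mem_ofPred_eq, exists_prop]
  refine ⟨fun hx => ⟨𝒢.cell k x, ⟨⟨x, rfl⟩, fun y hy => hS hy hx⟩, 𝒢.mem_cell k x⟩, ?_⟩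
  rintro ⟨C, ⟨-, hC⟩, hx⟩
  exact hC hx

variable (𝒢)

lemma saturated_cell (k : ℕ) (x : X) : 𝒢.Saturated k (𝒢.cell k x) := fun y z hz hy => by
  rwa [𝒢.cell_eq hy] at hz

lemma countable_cells (k : ℕ) (S : Set X) :
    {C ∈ Set.range (𝒢.cell k) | C ⊆ S}.Countable :=
  (𝒢.countable_range_cell k).mono fun _ h => h.1

lemma pairwiseDisjoint_cells (k : ℕ) (S : Set X) :
    {C ∈ Set.range (𝒢.cell k) | C ⊆ S}.PairwiseDisjoint id := by
  rintro _ ⟨⟨x, rfl⟩, -⟩ _ ⟨⟨y, rfl⟩, -⟩ hne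
  refine Set.disjoint_left.2 fun z hzx hzy => hne ?_
  rw [← 𝒢.cell_eq hzx, ← 𝒢.cell_eq hzy]

variable {𝒢}

lemma Saturated.measurableSet {k : ℕ} {S : Set X} (hS : 𝒢.Saturated k S) : MeasurableSet S := by
  rw [hS.eq_biUnion]
  refine MeasurableSet.biUnion (𝒢.countable_cells k S) ?_
  rintro _ ⟨⟨x, rfl⟩, -⟩
  exact 𝒢.measurableSet_cell k x

lemma Saturated.lintegral_eq_tsum {k : ℕ} {S : Set X} (hS : 𝒢.Saturated k S) (u : X → ℝ≥0∞) :
    ∫⁻ x in S, u x ∂μ =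
      ∑' C : {C ∈ Set.range (𝒢.cell k) | C ⊆ S}, ∫⁻ x in (C : Set X), u x ∂μ := by
  conv_lhs => rw [hS.eq_biUnion]
  refine lintegral_biUnion (𝒢.countable_cells k S) ?_ (𝒢.pairwiseDisjoint_cells k S) u
  rintro _ ⟨⟨x, rfl⟩, -⟩
  exact 𝒢.measurableSet_cell k x

/-- A measure estimate on cells extends to saturated sets. -/
lemma Saturated.measure_inter_le {k : ℕ} {S B : Set X} (hS : 𝒢.Saturated k S) (c : ℝ≥0∞)
    (h : ∀ x, μ (B ∩ 𝒢.cell k x) ≤ c * μ (𝒢.cell k x)) : μ (B ∩ S) ≤ c * μ S := by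
  have hm : μ S = ∑' C : {C ∈ Set.range (𝒢.cell k) | C ⊆ S}, μ (C : Set X) := by
    simpa using hS.lintegral_eq_tsum fun _ => 1
  calc μ (B ∩ S) ≤ μ (⋃ C ∈ {C ∈ Set.range (𝒢.cell k) | C ⊆ S}, B ∩ C) := by
        conv_lhs => rw [hS.eq_biUnion, Set.inter_iUnion₂]
    _ ≤ ∑' C : {C ∈ Set.range (𝒢.cell k) | C ⊆ S}, μ (B ∩ C) :=
        measure_biUnion_le μ (𝒢.countable_cells k S) _
    _ ≤ ∑' C : {C ∈ Set.range (𝒢.cell k) | C ⊆ S}, c * μ (C : Set X) := by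
        refine ENNReal.tsum_le_tsum ?_
        rintro ⟨_, ⟨x, rfl⟩, -⟩
        exact h x
    _ = c * μ S := by rw [ENNReal.tsum_mul_left, hm]

variable (𝒢)

/-- The average of `u` over the cell of level `k` containing `x`. -/
def avg (k : ℕ) (u : X → ℝ≥0∞) (x : X) : ℝ≥0∞ := (∫⁻ y in 𝒢.cell k x, u y ∂μ) / μ (𝒢.cell k x)

lemma avg_eq_of_mem {k : ℕ} {x y : X} (h : y ∈ 𝒢.cell k x) (u : X → ℝ≥0∞) :
    𝒢.avg k u y = 𝒢.avg k u x := by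
  rw [avg, avg, 𝒢.cell_eq h]

lemma saturated_of_invariant {k : ℕ} {p : X → Prop}
    (h : ∀ x y, y ∈ 𝒢.cell k x → p x → p y) : 𝒢.Saturated k {x | p x} :=
  fun x y hy hx => h x y hy hx

lemma measurable_avg (k : ℕ) (u : X → ℝ≥0∞) : Measurable (𝒢.avg k u) := fun s _ =>
  Saturated.measurableSet (𝒢 := 𝒢) (k := k) fun x y hy hx => by
    simpa only [Set.mem_preimage, 𝒢.avg_eq_of_mem hy u] using hx

lemma avg_mono (k : ℕ) {u v : X → ℝ≥0∞} (h : u ≤ v) : 𝒢.avg k u ≤ 𝒢.avg k v := fun _ =>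
  ENNReal.div_le_div_right (lintegral_mono h) _

lemma avg_const (k : ℕ) (c : ℝ≥0∞) (x : X) : 𝒢.avg k (fun _ => c) x = c := by
  rw [avg, setLIntegral_const,
    ENNReal.mul_div_cancel_right (𝒢.measure_cell_ne_zero k x) (𝒢.measure_cell_ne_top k x)]

lemma avg_add (k : ℕ) {u : X → ℝ≥0∞} (hu : Measurable u) (v : X → ℝ≥0∞) (x : X) :
    𝒢.avg k (fun y => u y + v y) x = 𝒢.avg k u x + 𝒢.avg k v x := by
  rw [avg, avg, avg, lintegral_add_left hu, ENNReal.add_div]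

lemma avg_mul_measure (k : ℕ) (u : X → ℝ≥0∞) (x : X) :
    𝒢.avg k u x * μ (𝒢.cell k x) = ∫⁻ y in 𝒢.cell k x, u y ∂μ :=
  ENNReal.div_mul_cancel (𝒢.measure_cell_ne_zero k x) (𝒢.measure_cell_ne_top k x)

lemma avg_succ_le (k : ℕ) (u : X → ℝ≥0∞) (x : X) :
    𝒢.avg (k + 1) u x ≤ D * 𝒢.avg k u x := by
  rw [avg, ENNReal.div_le_iff (𝒢.measure_cell_ne_zero _ x) (𝒢.measure_cell_ne_top _ x)]
  calc ∫⁻ y in 𝒢.cell (k + 1) x, u y ∂μ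
      ≤ ∫⁻ y in 𝒢.cell k x, u y ∂μ := lintegral_mono_set (𝒢.cell_succ_subset k x)
    _ = 𝒢.avg k u x * μ (𝒢.cell k x) := (𝒢.avg_mul_measure k u x).symm
    _ ≤ 𝒢.avg k u x * (D * μ (𝒢.cell (k + 1) x)) := by gcongr; exact 𝒢.measure_cell_le k x
    _ = D * 𝒢.avg k u x * μ (𝒢.cell (k + 1) x) := by ring

variable {𝒢}

lemma Saturated.lintegral_avg {k : ℕ} {S : Set X} (hS : 𝒢.Saturated k S) (u : X → ℝ≥0∞) :
    ∫⁻ x in S, 𝒢.avg k u x ∂μ = ∫⁻ x in S, u x ∂μ := by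
  rw [hS.lintegral_eq_tsum, hS.lintegral_eq_tsum]
  refine tsum_congr ?_
  rintro ⟨_, ⟨x, rfl⟩, -⟩
  rw [← 𝒢.avg_mul_measure k u x, ← setLIntegral_const]
  exact setLIntegral_congr_fun (𝒢.measurableSet_cell k x) fun y hy => 𝒢.avg_eq_of_mem hy u

/-- The stopping-time property: first entry at level i is decided by the cell of level i alone. -/
lemma saturated_firstHit {p : ℕ → Set X} (hp : ∀ l, 𝒢.Saturated l (p l)) (k i : ℕ) :
    𝒢.Saturated i (firstHit p k i) := fun _ _ hy hx =>
  ⟨hx.1, hp i hy hx.2.1, fun l hkl hli => ((hp l).compl.mono hli.le) hy (hx.2.2 l hkl hli)⟩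

lemma saturated_inter_firstHit {p : ℕ → Set X} (hp : ∀ l, 𝒢.Saturated l (p l)) {k : ℕ} {S : Set X}
    (hS : 𝒢.Saturated k S) (i : ℕ) : 𝒢.Saturated i (S ∩ firstHit p k i) :=
  fun _ _ hy hx => ⟨hS.mono hx.2.1 hy hx.1, saturated_firstHit hp k i hy hx.2⟩

lemma measurableSet_firstHit {p : ℕ → Set X} (hp : ∀ l, 𝒢.Saturated l (p l)) (k i : ℕ) :
    MeasurableSet (firstHit p k i) := (saturated_firstHit hp k i).measurableSet

variable (𝒢)

lemma saturated_lt_avg (u : X → ℝ≥0∞) (c : ℝ≥0∞) (l : ℕ) : 𝒢.Saturated l {x | c < 𝒢.avg l u x} :=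
  𝒢.saturated_of_invariant fun x y hy hx => by rwa [𝒢.avg_eq_of_mem hy u]

/-- The maximal function over the cells of level at least `k`. -/
def maxFrom (k : ℕ) (u : X → ℝ≥0∞) (x : X) : ℝ≥0∞ := ⨆ (i : ℕ) (_ : k ≤ i), 𝒢.avg i u x

lemma measurable_maxFrom (k : ℕ) (u : X → ℝ≥0∞) : Measurable (𝒢.maxFrom k u) :=
  Measurable.iSup fun i => Measurable.iSup fun _ => 𝒢.measurable_avg i u

lemma lt_maxFrom_iff {k : ℕ} {u : X → ℝ≥0∞} {x : X} {c : ℝ≥0∞} :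
    c < 𝒢.maxFrom k u x ↔ ∃ i, k ≤ i ∧ c < 𝒢.avg i u x := by
  simp [maxFrom, lt_iSup_iff]

variable {𝒢}

/-- The weak type (1,1) inequality for the maximal function of a nested partition. -/
lemma Saturated.mul_measure_lt_maxFrom_le {k : ℕ} {S : Set X} (hS : 𝒢.Saturated k S)
    (u : X → ℝ≥0∞) (c : ℝ≥0∞) :
    c * μ (S ∩ {x | c < 𝒢.maxFrom k u x}) ≤ ∫⁻ x in S, u x ∂μ := by
  -- Pieces where the average first exceeds c are disjoint unions of cells, each with average above
  -- c.
  set p : ℕ → Set X := fun l => {x | c < 𝒢.avg l u x} with hp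
  have hps : ∀ l, 𝒢.Saturated l (p l) := 𝒢.saturated_lt_avg u c
  have hT : ∀ i, 𝒢.Saturated i (S ∩ firstHit p k i) := saturated_inter_firstHit hps hS
  have hd : Pairwise (Function.onFun Disjoint fun i => S ∩ firstHit p k i) := fun i j hij =>
    (pairwise_disjoint_firstHit p k hij).mono Set.inter_subset_right Set.inter_subset_right
  have hsub : S ∩ {x | c < 𝒢.maxFrom k u x} ⊆ ⋃ i, S ∩ firstHit p k i := by
    rintro x ⟨hxS, hx⟩
    obtain ⟨i, hki, hi⟩ := 𝒢.lt_maxFrom_iff.1 hx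
    obtain ⟨j, -, hj⟩ := exists_mem_firstHit (p := p) hki hi
    exact Set.mem_iUnion.2 ⟨j, hxS, hj⟩
  calc c * μ (S ∩ {x | c < 𝒢.maxFrom k u x})
      ≤ c * ∑' i, μ (S ∩ firstHit p k i) := by
        gcongr
        exact (measure_mono hsub).trans (measure_iUnion_le _)
    _ = ∑' i, c * μ (S ∩ firstHit p k i) := ENNReal.tsum_mul_left.symm
    _ ≤ ∑' i, ∫⁻ x in S ∩ firstHit p k i, u x ∂μ := by
        refine ENNReal.tsum_le_tsum fun i => ?_
        rw [← (hT i).lintegral_avg, ← setLIntegral_const]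
        exact setLIntegral_mono (𝒢.measurable_avg i u) fun x hx => hx.2.2.1.le
    _ = ∫⁻ x in ⋃ i, S ∩ firstHit p k i, u x ∂μ :=
        (lintegral_iUnion (fun i => (hT i).measurableSet) hd u).symm
    _ ≤ ∫⁻ x in S, u x ∂μ := lintegral_mono_set (Set.iUnion_subset fun i => Set.inter_subset_left)

end NestedPartition

/-! ### Minkowski's inequality and the layer cake formula -/

/-- Minkowski's integral inequality for the `ℓ^q` norm. -/
lemma tsum_lintegral_rpow_le {X : Type*} [MeasurableSpace X] (ν : Measure X) {q : ℝ} (hq : 1 < q)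
    {g : ℕ → X → ℝ≥0∞} (hg : ∀ j, Measurable (g j)) :
    ∑' j, (∫⁻ x, g j x ∂ν) ^ q ≤ (∫⁻ x, (∑' j, g j x ^ q) ^ (1 / q) ∂ν) ^ q := by
  have hq0 : 0 < q := by linarith
  have hpq : (Real.conjExponent q).HolderConjugate q :=
    (Real.HolderConjugate.conjExponent hq).symm
  set h : X → ℝ≥0∞ := fun x => (∑' j, g j x ^ q) ^ (1 / q) with hh
  have hle : ∀ j x, g j x ≤ h x := fun j x => by
    calc g j x = (g j x ^ q) ^ (1 / q) := by
          rw [← ENNReal.rpow_mul, mul_one_div_cancel hq0.ne', ENNReal.rpow_one]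
      _ ≤ h x := ENNReal.rpow_le_rpow (ENNReal.le_tsum j) (by positivity)
  by_cases htop : ∫⁻ x, h x ∂ν = ∞
  · rw [htop, ENNReal.top_rpow_of_pos hq0]; exact le_top
  have hfin : ∀ j, ∫⁻ x, g j x ∂ν ≠ ∞ := fun j =>
    ne_top_of_le_ne_top htop (lintegral_mono (hle j))
  -- A partial sum A is finite, so A^(1/q') can be cancelled from the Hölder bound A ≤ A^(1/q') ∫ h.
  refine ENNReal.tsum_le_of_sum_range_le fun N => ?_
  set s := Finset.range N
  set A : ℝ≥0∞ := ∑ j ∈ s, (∫⁻ x, g j x ∂ν) ^ q with hA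
  have hAtop : A ≠ ∞ := ENNReal.sum_ne_top.2 fun j _ =>
    ENNReal.rpow_ne_top_of_nonneg hq0.le (hfin j)
  rcases eq_or_ne A 0 with hA0 | hA0
  · rw [hA0]; exact zero_le
  have hexp : (q - 1) * Real.conjExponent q = q := by
    rw [Real.conjExponent]; field_simp [sub_ne_zero.2 hq.ne']
  have key : A ≤ A ^ (1 / Real.conjExponent q) * ∫⁻ x, h x ∂ν := by
    calc A = ∑ j ∈ s, ∫⁻ x, (∫⁻ x, g j x ∂ν) ^ (q - 1) * g j x ∂ν := by
          refine Finset.sum_congr rfl fun j _ => ?_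
          rw [lintegral_const_mul _ (hg j)]
          conv_rhs => rw [← ENNReal.rpow_one (∫⁻ x, g j x ∂ν), ← ENNReal.rpow_mul]
          rw [← ENNReal.rpow_add_of_nonneg _ _ (by linarith) (by norm_num)]
          congr 1; ring
      _ = ∫⁻ x, ∑ j ∈ s, (∫⁻ x, g j x ∂ν) ^ (q - 1) * g j x ∂ν :=
          (lintegral_finsetSum _ fun j _ => (hg j).const_mul _).symm
      _ ≤ ∫⁻ x, A ^ (1 / Real.conjExponent q) * h x ∂ν := by
          refine lintegral_mono fun x => ?_
          refine (ENNReal.inner_le_Lp_mul_Lq s _ _ hpq).trans ?_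
          refine mul_le_mul' ?_ ?_
          · simp_rw [← ENNReal.rpow_mul, hexp]; exact le_rfl
          · exact ENNReal.rpow_le_rpow (ENNReal.sum_le_tsum s) (by positivity)
      _ = A ^ (1 / Real.conjExponent q) * ∫⁻ x, h x ∂ν :=
          lintegral_const_mul _
            ((Measurable.tsum fun j => (hg j).pow_const q).pow_const _)
  have hsplit : A = A ^ (1 / Real.conjExponent q) * A ^ (1 / q) := by
    rw [← ENNReal.rpow_add _ _ hA0 hAtop, one_div, one_div, hpq.inv_add_inv_eq_one,
      ENNReal.rpow_one]
  have h1 : A ^ (1 / q) ≤ ∫⁻ x, h x ∂ν := by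
    have hne : A ^ (1 / Real.conjExponent q) ≠ 0 := by simp [ENNReal.rpow_eq_zero_iff, hA0, hAtop]
    have hnt : A ^ (1 / Real.conjExponent q) ≠ ∞ := by simp [ENNReal.rpow_eq_top_iff, hA0, hAtop]
    rw [← ENNReal.mul_le_mul_iff_right hne hnt, ← hsplit]
    exact key
  calc A = (A ^ (1 / q)) ^ q := by
        rw [← ENNReal.rpow_mul, one_div_mul_cancel hq0.ne', ENNReal.rpow_one]
    _ ≤ _ := ENNReal.rpow_le_rpow h1 hq0.le

/-- The layer cake formula for a constant. -/
lemma lintegral_ofReal_lt_rpow {p : ℝ} (hp : 0 < p) (a : ℝ≥0∞) :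
    ∫⁻ t in Set.Ioi (0 : ℝ), {t : ℝ | ENNReal.ofReal t < a}.indicator
      (fun t => ENNReal.ofReal (p * t ^ (p - 1))) t = a ^ p := by
  have hfin : ∀ r : ℝ, 0 ≤ r →
      ∫⁻ t in Set.Ioo (0 : ℝ) r, ENNReal.ofReal (p * t ^ (p - 1)) = ENNReal.ofReal r ^ p := by
    intro r hr
    have hint : IntervalIntegrable (fun t : ℝ => p * t ^ (p - 1)) volume 0 r :=
      (intervalIntegral.intervalIntegrable_rpow' (by linarith)).const_mul p
    rw [setLIntegral_congr Ioo_ae_eq_Ioc, ← ofReal_integral_eq_lintegral_ofReal,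
      ← intervalIntegral.integral_of_le hr, intervalIntegral.integral_const_mul,
      integral_rpow (Or.inl (by linarith)), ENNReal.ofReal_rpow_of_nonneg hr hp.le]
    · congr 1
      rw [sub_add_cancel, Real.zero_rpow hp.ne', sub_zero]
      field_simp
    · exact (intervalIntegrable_iff_integrableOn_Ioc_of_le hr).1 hint
    · filter_upwards [ae_restrict_mem measurableSet_Ioc] with t ht
      have := ht.1
      positivity
  have hm : MeasurableSet {t : ℝ | ENNReal.ofReal t < a} :=
    measurableSet_lt ENNReal.measurable_ofReal measurable_const
  rw [setLIntegral_indicator hm]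
  rcases eq_or_ne a ∞ with rfl | ha
  · rw [ENNReal.top_rpow_of_pos hp, eq_top_iff]
    refine ENNReal.le_of_forall_nnreal_lt fun r _ => ?_
    calc (r : ℝ≥0∞) = ENNReal.ofReal ((r : ℝ) ^ (1 / p)) ^ p := by
          rw [ENNReal.ofReal_rpow_of_nonneg (by positivity) hp.le, ← Real.rpow_mul r.coe_nonneg,
            one_div_mul_cancel hp.ne', Real.rpow_one, ENNReal.ofReal_coe_nnreal]
      _ = ∫⁻ t in Set.Ioo (0 : ℝ) ((r : ℝ) ^ (1 / p)), ENNReal.ofReal (p * t ^ (p - 1)) :=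
          (hfin _ (by positivity)).symm
      _ ≤ _ := lintegral_mono_set (by intro t ht; exact ⟨ENNReal.ofReal_lt_top, ht.1⟩)
  · have hset : {t : ℝ | ENNReal.ofReal t < a} ∩ Set.Ioi 0 = Set.Ioo 0 a.toReal := by
      ext t
      simp only [Set.mem_inter_iff, Set.mem_ofPred_eq, Set.mem_Ioi, Set.mem_Ioo]
      rw [and_comm]
      exact and_congr_right fun ht => ENNReal.ofReal_lt_iff_lt_toReal ht.le ha
    rw [hset, hfin _ ENNReal.toReal_nonneg, ENNReal.ofReal_toReal ha]

/-! ### Strong type (q,q) -/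

namespace NestedPartition

variable {X : Type*} [MeasurableSpace X] {μ : Measure X} {D : ℝ≥0∞} {𝒢 : NestedPartition μ D}

/-- Cut u at height t/2: the low part contributes at most t/2 to any average, so the high part must
supply an average above t/2, and the weak type inequality applies to it. -/
lemma Saturated.measure_ofReal_lt_maxFrom_le {k : ℕ} {S : Set X} (hS : 𝒢.Saturated k S)
    {u : X → ℝ≥0∞} (hu : Measurable u) {t : ℝ} (ht : 0 < t) :
    μ (S ∩ {x | ENNReal.ofReal t < 𝒢.maxFrom k u x}) ≤
      ENNReal.ofReal (2 / t) * ∫⁻ x in S, {x | ENNReal.ofReal t < 2 * u x}.indicator u x ∂μ := by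
  set c := ENNReal.ofReal (t / 2) with hc
  have hc2 : ENNReal.ofReal t = c + c := by
    rw [hc, ← ENNReal.ofReal_add (by positivity) (by positivity), add_halves]
  set E : Set X := {x | ENNReal.ofReal t < 2 * u x}
  have hE : MeasurableSet E := measurableSet_lt measurable_const (hu.const_mul 2)
  have hsplit : u ≤ fun x => E.indicator u x + c := by
    intro x
    by_cases hx : x ∈ E
    · simp [hx]
    · have h2 : 2 * u x ≤ 2 * c := by rw [two_mul c, ← hc2]; exact not_lt.1 hx
      have := (ENNReal.mul_le_mul_iff_right two_ne_zero ENNReal.ofNat_ne_top).1 h2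
      simpa [hx] using this
  have hsub : S ∩ {x | ENNReal.ofReal t < 𝒢.maxFrom k u x} ⊆
      S ∩ {x | c < 𝒢.maxFrom k (E.indicator u) x} := by
    rintro x ⟨hxS, hx⟩
    obtain ⟨i, hki, hi⟩ := 𝒢.lt_maxFrom_iff.1 hx
    refine ⟨hxS, 𝒢.lt_maxFrom_iff.2 ⟨i, hki, ?_⟩⟩
    have h1 : c + c < 𝒢.avg i (E.indicator u) x + c := by
      rw [← hc2]
      refine hi.trans_le ((𝒢.avg_mono i hsplit x).trans_eq ?_)
      rw [𝒢.avg_add i (hu.indicator hE), 𝒢.avg_const]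
    exact lt_of_add_lt_add_right h1
  have hw := hS.mul_measure_lt_maxFrom_le (E.indicator u) c
  have hinv : ENNReal.ofReal (2 / t) * c = 1 := by
    rw [hc, ← ENNReal.ofReal_mul (by positivity)]
    field_simp
    simp
  calc μ (S ∩ {x | ENNReal.ofReal t < 𝒢.maxFrom k u x})
      ≤ ENNReal.ofReal (2 / t) * (c * μ (S ∩ {x | c < 𝒢.maxFrom k (E.indicator u) x})) := by
        rw [← mul_assoc, hinv, one_mul]; exact measure_mono hsub
    _ ≤ _ := by gcongr

/-- The constant in the strong type inequality for the maximal function. -/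
def strongConst (q : ℝ) : ℝ≥0∞ := ENNReal.ofReal (2 * q / (q - 1)) * 2 ^ (q - 1)

lemma strongConst_ne_top {q : ℝ} (hq : 1 < q) : strongConst q ≠ ∞ :=
  ENNReal.mul_ne_top ENNReal.ofReal_ne_top
    (ENNReal.rpow_ne_top_of_nonneg (by linarith) ENNReal.ofNat_ne_top)

/-- The strong type inequality for the maximal function of a nested partition. -/
lemma Saturated.lintegral_maxFrom_rpow_le [SFinite μ] {k : ℕ} {S : Set X} (hS : 𝒢.Saturated k S)
    {u : X → ℝ≥0∞} (hu : Measurable u) {q : ℝ} (hq : 1 < q) :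
    ∫⁻ x in S, 𝒢.maxFrom k u x ^ q ∂μ ≤ strongConst q * ∫⁻ x in S, u x ^ q ∂μ := by
  have hq0 : 0 < q := by linarith
  have hq1 : 0 < q - 1 := by linarith
  have hM := 𝒢.measurable_maxFrom k u
  have hm1 : MeasurableSet {z : X × ℝ | ENNReal.ofReal z.2 < 𝒢.maxFrom k u z.1} :=
    measurableSet_lt (ENNReal.measurable_ofReal.comp measurable_snd) (hM.comp measurable_fst)
  have hm2 : MeasurableSet {z : ℝ × X | ENNReal.ofReal z.1 < 2 * u z.2} :=
    measurableSet_lt (ENNReal.measurable_ofReal.comp measurable_fst)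
      ((hu.comp measurable_snd).const_mul 2)
  calc ∫⁻ x in S, 𝒢.maxFrom k u x ^ q ∂μ
      = ∫⁻ x in S, (∫⁻ t in Set.Ioi (0 : ℝ), {t : ℝ | ENNReal.ofReal t < 𝒢.maxFrom k u x}.indicator
          (fun t => ENNReal.ofReal (q * t ^ (q - 1))) t) ∂μ := by
        simp_rw [lintegral_ofReal_lt_rpow hq0]
    _ = ∫⁻ t in Set.Ioi (0 : ℝ), ∫⁻ x in S, {t : ℝ | ENNReal.ofReal t < 𝒢.maxFrom k u x}.indicator
          (fun t => ENNReal.ofReal (q * t ^ (q - 1))) t ∂μ := by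
        refine lintegral_lintegral_swap (Measurable.aemeasurable ?_)
        refine Measurable.indicator (s := {z : X × ℝ | ENNReal.ofReal z.2 < 𝒢.maxFrom k u z.1})
          (f := fun z : X × ℝ => ENNReal.ofReal (q * z.2 ^ (q - 1))) ?_ hm1
        fun_prop
    _ ≤ ∫⁻ t in Set.Ioi (0 : ℝ), ∫⁻ x in S, {x | ENNReal.ofReal t < 2 * u x}.indicator
          (fun x => ENNReal.ofReal (2 * q / (q - 1)) *
            ENNReal.ofReal ((q - 1) * t ^ (q - 1 - 1)) * u x) x ∂μ := by
        refine setLIntegral_mono' measurableSet_Ioi fun t ht => ?_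
        have ht0 : 0 < t := ht
        have hE : MeasurableSet {x | ENNReal.ofReal t < 2 * u x} :=
          measurableSet_lt measurable_const (hu.const_mul 2)
        have hF : MeasurableSet {x | ENNReal.ofReal t < 𝒢.maxFrom k u x} :=
          measurableSet_lt measurable_const hM
        -- Puts the weight in the form required by the layer cake formula with exponent q - 1, used
        -- below for the inner integral in t.
        have hcoef : ENNReal.ofReal (q * t ^ (q - 1)) * ENNReal.ofReal (2 / t) =
            ENNReal.ofReal (2 * q / (q - 1)) * ENNReal.ofReal ((q - 1) * t ^ (q - 1 - 1)) := by
          rw [← ENNReal.ofReal_mul (by positivity), ← ENNReal.ofReal_mul (by positivity),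
            Real.rpow_sub_one ht0.ne' (q - 1)]
          congr 1
          field_simp
        calc ∫⁻ x in S, {t : ℝ | ENNReal.ofReal t < 𝒢.maxFrom k u x}.indicator
              (fun t => ENNReal.ofReal (q * t ^ (q - 1))) t ∂μ
            = ∫⁻ x in S, {x | ENNReal.ofReal t < 𝒢.maxFrom k u x}.indicator
              (fun _ => ENNReal.ofReal (q * t ^ (q - 1))) x ∂μ := rfl
          _ = ENNReal.ofReal (q * t ^ (q - 1)) *
              μ (S ∩ {x | ENNReal.ofReal t < 𝒢.maxFrom k u x}) := by
              rw [lintegral_indicator_const hF, Measure.restrict_apply hF, Set.inter_comm]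
          _ ≤ ENNReal.ofReal (q * t ^ (q - 1)) * (ENNReal.ofReal (2 / t) *
              ∫⁻ x in S, {x | ENNReal.ofReal t < 2 * u x}.indicator u x ∂μ) := by
              gcongr
              exact hS.measure_ofReal_lt_maxFrom_le hu ht0
          _ = _ := by
              rw [← mul_assoc, hcoef, ← lintegral_const_mul _ (hu.indicator hE)]
              refine lintegral_congr fun x => ?_
              by_cases hx : x ∈ {x | ENNReal.ofReal t < 2 * u x} <;> simp [hx]
    _ = ∫⁻ x in S, (∫⁻ t in Set.Ioi (0 : ℝ), {x | ENNReal.ofReal t < 2 * u x}.indicator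
          (fun x => ENNReal.ofReal (2 * q / (q - 1)) *
            ENNReal.ofReal ((q - 1) * t ^ (q - 1 - 1)) * u x) x) ∂μ := by
        refine lintegral_lintegral_swap (Measurable.aemeasurable ?_)
        refine Measurable.indicator (s := {z : ℝ × X | ENNReal.ofReal z.1 < 2 * u z.2})
          (f := fun z : ℝ × X => ENNReal.ofReal (2 * q / (q - 1)) *
            ENNReal.ofReal ((q - 1) * z.1 ^ (q - 1 - 1)) * u z.2) ?_ hm2
        fun_prop
    _ = ∫⁻ x in S, strongConst q * u x ^ q ∂μ := by
        refine lintegral_congr fun x => ?_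
        calc ∫⁻ t in Set.Ioi (0 : ℝ), {x | ENNReal.ofReal t < 2 * u x}.indicator
              (fun x => ENNReal.ofReal (2 * q / (q - 1)) *
                ENNReal.ofReal ((q - 1) * t ^ (q - 1 - 1)) * u x) x
            = ∫⁻ t in Set.Ioi (0 : ℝ), (ENNReal.ofReal (2 * q / (q - 1)) * u x) *
                {t : ℝ | ENNReal.ofReal t < 2 * u x}.indicator
                  (fun t => ENNReal.ofReal ((q - 1) * t ^ (q - 1 - 1))) t := by
              refine lintegral_congr fun t => ?_
              by_cases hx : ENNReal.ofReal t < 2 * u x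
              · simp [hx]; ring
              · simp [hx]
          _ = (ENNReal.ofReal (2 * q / (q - 1)) * u x) * (2 * u x) ^ (q - 1) := by
              rw [lintegral_const_mul, lintegral_ofReal_lt_rpow hq1]
              refine Measurable.indicator (by fun_prop)
                (measurableSet_lt ENNReal.measurable_ofReal measurable_const)
          _ = strongConst q * (u x ^ (1 : ℝ) * u x ^ (q - 1)) := by
              rw [ENNReal.mul_rpow_of_nonneg _ _ hq1.le, strongConst, ENNReal.rpow_one]; ring
          _ = strongConst q * u x ^ q := by
              rw [← ENNReal.rpow_add_of_nonneg _ _ zero_le_one hq1.le, add_sub_cancel]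
    _ = strongConst q * ∫⁻ x in S, u x ^ q ∂μ := lintegral_const_mul _ (hu.pow_const q)

end NestedPartition

/-! ### Vector-valued maximal functions, truncated by level -/

lemma iSup_rpow {ι : Sort*} (f : ι → ℝ≥0∞) {q : ℝ} (hq : 0 < q) : (⨆ i, f i) ^ q = ⨆ i, f i ^ q :=
  (ENNReal.orderIsoRpow q hq).map_iSup f

lemma tsum_iSup_le {f : ℕ → ℕ → ℝ≥0∞} (hf : ∀ j, Monotone (f j)) {c : ℝ≥0∞}
    (h : ∀ N, ∑' j, f j N ≤ c) : ∑' j, ⨆ N, f j N ≤ c := by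
  refine ENNReal.tsum_le_of_sum_range_le fun J => ?_
  rw [ENNReal.finsetSum_iSup_of_monotone hf]
  exact iSup_le fun N => (ENNReal.sum_le_tsum _).trans (h N)

namespace NestedPartition

variable {X : Type*} [MeasurableSpace X] {μ : Measure X} {D : ℝ≥0∞} (𝒢 : NestedPartition μ D)

/-- The maximal function over the cells of levels between `k` and `N`. -/
def maxBetween (k N : ℕ) (u : X → ℝ≥0∞) (x : X) : ℝ≥0∞ :=
  ⨆ (i : ℕ) (_ : k ≤ i ∧ i ≤ N), 𝒢.avg i u x

lemma monotone_maxBetween (k : ℕ) (u : X → ℝ≥0∞) (x : X) :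
    Monotone fun N => 𝒢.maxBetween k N u x := fun _ _ hN =>
  iSup_mono fun _ => iSup_mono' fun hi => ⟨⟨hi.1, hi.2.trans hN⟩, le_rfl⟩

lemma maxBetween_eq_of_mem (k : ℕ) {N : ℕ} {x y : X} (h : y ∈ 𝒢.cell N x) (u : X → ℝ≥0∞) :
    𝒢.maxBetween k N u y = 𝒢.maxBetween k N u x :=
  iSup_congr fun _ => iSup_congr fun hi => 𝒢.avg_eq_of_mem (𝒢.cell_anti x hi.2 h) u

lemma maxFrom_eq_iSup (k : ℕ) (u : X → ℝ≥0∞) (x : X) :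
    𝒢.maxFrom k u x = ⨆ N, 𝒢.maxBetween k N u x := by
  refine le_antisymm (iSup₂_le fun i hi => ?_) (iSup_le fun N => iSup₂_le fun i hi => ?_)
  · exact le_iSup_of_le i (le_iSup₂_of_le i ⟨hi, le_rfl⟩ le_rfl)
  · exact le_iSup₂_of_le i hi.1 le_rfl

lemma maxFrom_le_max (k i : ℕ) (u : X → ℝ≥0∞) (x : X) :
    𝒢.maxFrom k u x ≤ max (𝒢.maxBetween k (i - 1) u x) (𝒢.maxFrom i u x) := by
  refine iSup₂_le fun l hl => ?_
  rcases lt_or_ge l i with h | h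
  · exact le_max_of_le_left (le_iSup₂_of_le l ⟨hl, by omega⟩ le_rfl)
  · exact le_max_of_le_right (le_iSup₂_of_le l h le_rfl)

/-- The sum of the `q`-th powers of the maximal functions over cells of level at least `k`. -/
def vecMaxFrom (q : ℝ) (g : ℕ → X → ℝ≥0∞) (k : ℕ) (x : X) : ℝ≥0∞ :=
  ∑' j, 𝒢.maxFrom k (g j) x ^ q

/-- The sum of the `q`-th powers of the maximal functions over cells of levels between `k`
and `N`. -/
def vecMaxBetween (q : ℝ) (g : ℕ → X → ℝ≥0∞) (k N : ℕ) (x : X) : ℝ≥0∞ :=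
  ∑' j, 𝒢.maxBetween k N (g j) x ^ q

lemma vecMaxBetween_mono {q : ℝ} (hq : 0 < q) (g : ℕ → X → ℝ≥0∞) (k : ℕ) (x : X) :
    Monotone fun N => 𝒢.vecMaxBetween q g k N x := fun _ _ hN =>
  ENNReal.tsum_le_tsum fun j => ENNReal.rpow_le_rpow (𝒢.monotone_maxBetween k (g j) x hN) hq.le

lemma vecMaxFrom_le {q : ℝ} (hq : 0 < q) {g : ℕ → X → ℝ≥0∞} {k : ℕ} {x : X} {c : ℝ≥0∞}
    (h : ∀ N, 𝒢.vecMaxBetween q g k N x ≤ c) : 𝒢.vecMaxFrom q g k x ≤ c := by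
  simp_rw [vecMaxFrom, maxFrom_eq_iSup, iSup_rpow _ hq]
  exact tsum_iSup_le (fun j N N' hN =>
    ENNReal.rpow_le_rpow (𝒢.monotone_maxBetween k (g j) x hN) hq.le) h

lemma vecMaxFrom_le_add {q : ℝ} (hq : 0 < q) (g : ℕ → X → ℝ≥0∞) (k i : ℕ) (x : X) :
    𝒢.vecMaxFrom q g k x ≤ 𝒢.vecMaxBetween q g k (i - 1) x + 𝒢.vecMaxFrom q g i x := by
  rw [vecMaxFrom, vecMaxBetween, vecMaxFrom, ← ENNReal.tsum_add]
  refine ENNReal.tsum_le_tsum fun j => ?_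
  refine (ENNReal.rpow_le_rpow (𝒢.maxFrom_le_max k i (g j) x) hq.le).trans ?_
  rw [(ENNReal.monotone_rpow_of_nonneg hq.le).map_max]
  exact max_le_add_of_nonneg zero_le zero_le

lemma saturated_lt_vecMaxBetween (q : ℝ) (g : ℕ → X → ℝ≥0∞) (k : ℕ) (c : ℝ≥0∞) (l : ℕ) :
    𝒢.Saturated l {x | c < 𝒢.vecMaxBetween q g k l x} :=
  𝒢.saturated_of_invariant fun x y hy hx => by
    simpa only [vecMaxBetween, 𝒢.maxBetween_eq_of_mem k hy] using hx

/-- The pointwise `ℓ^q` norm of a sequence of `[0,∞]`-valued functions. -/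
def lq (q : ℝ) (g : ℕ → X → ℝ≥0∞) (x : X) : ℝ≥0∞ := (∑' j, g j x ^ q) ^ (1 / q)

/-- Minkowski's integral inequality on one cell, normalized by its measure. -/
lemma tsum_avg_rpow_le {q : ℝ} (hq : 1 < q) {g : ℕ → X → ℝ≥0∞} (hg : ∀ j, Measurable (g j))
    (k : ℕ) (x : X) : ∑' j, 𝒢.avg k (g j) x ^ q ≤ 𝒢.avg k (lq q g) x ^ q := by
  have hq0 : 0 ≤ q := by linarith
  simp_rw [avg, ENNReal.div_rpow_of_nonneg _ _ hq0, div_eq_mul_inv]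
  rw [ENNReal.tsum_mul_right]
  gcongr
  exact tsum_lintegral_rpow_le _ hq hg

lemma avg_le_avg_lq {q : ℝ} (hq : 1 < q) {g : ℕ → X → ℝ≥0∞} (hg : ∀ j, Measurable (g j))
    (k j : ℕ) (x : X) : 𝒢.avg k (g j) x ≤ 𝒢.avg k (lq q g) x := by
  have hq0 : 0 < q := by linarith
  rw [← ENNReal.rpow_le_rpow_iff hq0]
  exact (ENNReal.le_tsum j).trans (𝒢.tsum_avg_rpow_le hq hg k x)

/-! ### Stopped averages and the half estimate -/

/-- The average of `u` over the cell at which the sequence `p` is first entered, starting from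
level `k`. -/
def stoppedAvg (p : ℕ → Set X) (k : ℕ) (u : X → ℝ≥0∞) (x : X) : ℝ≥0∞ :=
  ∑' i, (firstHit p k i).indicator (𝒢.avg i u) x

variable {𝒢}

lemma measurable_stoppedAvg {p : ℕ → Set X} (hp : ∀ l, 𝒢.Saturated l (p l)) (k : ℕ)
    (u : X → ℝ≥0∞) : Measurable (𝒢.stoppedAvg p k u) :=
  Measurable.tsum fun i => (𝒢.measurable_avg i u).indicator (measurableSet_firstHit hp k i)

lemma stoppedAvg_eq {p : ℕ → Set X} {k i : ℕ} {x : X} (hx : x ∈ firstHit p k i) (u : X → ℝ≥0∞) :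
    𝒢.stoppedAvg p k u x = 𝒢.avg i u x := by
  rw [stoppedAvg, tsum_eq_single i, Set.indicator_of_mem hx]
  intro j hj
  exact Set.indicator_of_notMem (fun hxj =>
    Set.disjoint_left.1 (pairwise_disjoint_firstHit p k hj) hxj hx) _

/-- The pieces partition S, and averaging at level i preserves the integral over a set saturated at
level i. -/
lemma lintegral_stoppedAvg {p : ℕ → Set X} {k : ℕ}
    {S : Set X} (hcov : ∀ x ∈ S, ∃ i, x ∈ firstHit p k i)
    (hS : ∀ i, 𝒢.Saturated i (S ∩ firstHit p k i)) (u : X → ℝ≥0∞) :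
    ∫⁻ x in S, 𝒢.stoppedAvg p k u x ∂μ = ∫⁻ x in S, u x ∂μ := by
  have hd : Pairwise (Function.onFun Disjoint fun i => S ∩ firstHit p k i) := fun i j hij =>
    (pairwise_disjoint_firstHit p k hij).mono Set.inter_subset_right Set.inter_subset_right
  have hU : S = ⋃ i, S ∩ firstHit p k i := by
    rw [← Set.inter_iUnion, eq_comm, Set.inter_eq_left]
    exact fun x hx => Set.mem_iUnion.2 (hcov x hx)
  rw [hU, lintegral_iUnion (fun i => (hS i).measurableSet) hd,
    lintegral_iUnion (fun i => (hS i).measurableSet) hd]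
  refine tsum_congr fun i => ?_
  rw [← (hS i).lintegral_avg u]
  exact setLIntegral_congr_fun (hS i).measurableSet fun x hx => stoppedAvg_eq hx.2 u

variable (𝒢)

/-- The constant in the estimate on half of a cell. -/
def halfConst (q : ℝ) (D : ℝ≥0∞) : ℝ≥0∞ := 4 * strongConst q * (4 * D) ^ q

lemma strongConst_ne_zero {q : ℝ} (hq : 1 < q) : strongConst q ≠ 0 := by
  refine mul_ne_zero ?_ (by simp [ENNReal.rpow_eq_zero_iff])
  have : 0 < 2 * q / (q - 1) := div_pos (by linarith) (by linarith)
  simpa using this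

lemma halfConst_ne_zero {q : ℝ} (hq : 1 < q) (hD : 1 ≤ D) : halfConst q D ≠ 0 := by
  have hD0 : D ≠ 0 := (zero_lt_one.trans_le hD).ne'
  have hq0 : ¬ q < 0 := by linarith
  simp [halfConst, strongConst_ne_zero hq, ENNReal.rpow_eq_zero_iff, hD0, hq0]

lemma halfConst_ne_top {q : ℝ} (hq : 1 < q) (hD : D ≠ ∞) : halfConst q D ≠ ∞ :=
  ENNReal.mul_ne_top (ENNReal.mul_ne_top ENNReal.ofNat_ne_top (strongConst_ne_top hq))
    (ENNReal.rpow_ne_top_of_nonneg (by linarith) (ENNReal.mul_ne_top ENNReal.ofNat_ne_top hD))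

/-- Truncation at level N lets the stopping rule stop at every point, so the stopped averages are
defined everywhere and no differentiation theorem is needed. -/
lemma measure_lt_vecMaxBetween_le [SFinite μ] {q : ℝ} (hq : 1 < q) (hD1 : 1 ≤ D) (hD : D ≠ ∞)
    {g : ℕ → X → ℝ≥0∞} (hg : ∀ j, Measurable (g j)) (k N : ℕ) (x₀ : X)
    (ha0 : 𝒢.avg k (lq q g) x₀ ≠ 0) (hat : 𝒢.avg k (lq q g) x₀ ≠ ∞) :
    μ (𝒢.cell k x₀ ∩
        {x | halfConst q D * 𝒢.avg k (lq q g) x₀ ^ q < 𝒢.vecMaxBetween q g k N x}) ≤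
      2⁻¹ * μ (𝒢.cell k x₀) := by
  have hq0 : 0 < q := by linarith
  set P := 𝒢.cell k x₀ with hP
  have hPs : 𝒢.Saturated k P := 𝒢.saturated_cell k x₀
  set h := lq q g with hh
  set a := 𝒢.avg k h x₀ with ha
  have haP : ∀ x ∈ P, 𝒢.avg k h x = a := fun x hx => 𝒢.avg_eq_of_mem hx h
  rcases lt_or_ge N k with hNk | hkN
  · have : ∀ x, 𝒢.vecMaxBetween q g k N x = 0 := fun x => by
      have hi : ∀ i, ¬ (k ≤ i ∧ i ≤ N) := fun i => by omega
      simp [vecMaxBetween, maxBetween, hi, ENNReal.zero_rpow_of_pos hq0]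
    simp [this]
  -- Stop when the average of the ℓ^q norm exceeds 4a, and at level N at the latest.
  set p : ℕ → Set X := fun l => {x | l = N ∨ 4 * a < 𝒢.avg l h x} with hp
  have hps : ∀ l, 𝒢.Saturated l (p l) := fun l =>
    𝒢.saturated_of_invariant fun x y hy hx => by rwa [𝒢.avg_eq_of_mem hy h]
  have hcov : ∀ x, ∃ i ≤ N, x ∈ firstHit p k i := fun x => exists_mem_firstHit hkN (Or.inl rfl)
  set Ω : Set X := {x | 4 * a < 𝒢.maxFrom k h x} with hΩ
  have hΩm : μ (P ∩ Ω) ≤ 4⁻¹ * μ P := by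
    have h1 := hPs.mul_measure_lt_maxFrom_le h (4 * a)
    rw [← 𝒢.avg_mul_measure k h x₀, ← ha, ← hP, ← hΩ, mul_comm 4 a, mul_assoc,
      ENNReal.mul_le_mul_iff_right ha0 hat] at h1
    rw [mul_comm, ← div_eq_mul_inv, ENNReal.le_div_iff_mul_le (by simp) (by simp), mul_comm]
    exact h1
  set v : ℕ → X → ℝ≥0∞ := fun j => 𝒢.stoppedAvg p k (g j) with hv
  have hvm : ∀ j, Measurable (v j) := fun j => measurable_stoppedAvg hps k (g j)
  have hvle : ∀ x ∈ P, ∑' j, v j x ^ q ≤ (4 * D * a) ^ q := by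
    intro x hx
    obtain ⟨i, hiN, hi⟩ := hcov x
    have h1 : 𝒢.avg i h x ≤ 4 * D * a := by
      -- Stopping at level k gives average a; otherwise the parent cell did not stop, and passing to
      -- a child costs a factor D.
      rcases eq_or_lt_of_le hi.1 with rfl | hki
      · rw [haP x hx]
        calc a = 1 * 1 * a := by simp
          _ ≤ 4 * D * a := by gcongr; norm_num
      · obtain ⟨m, rfl⟩ : ∃ m, i = m + 1 := ⟨i - 1, by omega⟩
        have h2 : x ∉ p m := hi.2.2 m (by omega) (by omega)
        simp only [hp, Set.mem_ofPred_eq, not_or, not_lt] at h2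
        calc 𝒢.avg (m + 1) h x ≤ D * 𝒢.avg m h x := 𝒢.avg_succ_le m h x
          _ ≤ D * (4 * a) := by gcongr; exact h2.2
          _ = 4 * D * a := by ring
    calc ∑' j, v j x ^ q = ∑' j, 𝒢.avg i (g j) x ^ q := by
          simp_rw [hv, stoppedAvg_eq hi]
      _ ≤ 𝒢.avg i h x ^ q := 𝒢.tsum_avg_rpow_le hq hg i x
      _ ≤ _ := ENNReal.rpow_le_rpow h1 hq0.le
  -- Off Ω no cell around x of level below i has stopped, so the cell of level i is a union of
  -- stopping cells and stopped averaging preserves its integral.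
  have havg : ∀ x ∉ Ω, ∀ i, k ≤ i → i ≤ N → ∀ u, 𝒢.avg i (𝒢.stoppedAvg p k u) x = 𝒢.avg i u x := by
    intro x hx i hki hiN u
    rw [avg, avg, lintegral_stoppedAvg (fun y _ => (hcov y).imp fun _ h => h.2)]
    intro l
    rcases le_or_gt i l with hil | hli
    · exact ((𝒢.saturated_cell i x).mono hil).inter (saturated_firstHit hps k l)
    · have : 𝒢.cell i x ∩ firstHit p k l = ∅ := by
        rw [Set.eq_empty_iff_forall_notMem]
        rintro y ⟨hyx, hy⟩
        rcases hy.2.1 with h1 | h1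
        · omega
        · rw [𝒢.avg_eq_of_mem (𝒢.cell_anti x hli.le hyx) h] at h1
          exact hx (𝒢.lt_maxFrom_iff.2 ⟨l, hy.1, h1⟩)
      rw [this]
      exact fun _ _ _ hx => hx.elim
  set G : X → ℝ≥0∞ := fun x => ∑' j, 𝒢.maxFrom k (v j) x ^ q with hG
  have hGm : Measurable G := Measurable.tsum fun j => (𝒢.measurable_maxFrom k (v j)).pow_const q
  have hFG : ∀ x ∉ Ω, 𝒢.vecMaxBetween q g k N x ≤ G x := fun x hx =>
    ENNReal.tsum_le_tsum fun j => ENNReal.rpow_le_rpow (iSup₂_le fun i hi => by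
      rw [← havg x hx i hi.1 hi.2 (g j)]
      exact le_iSup₂_of_le i hi.1 le_rfl) hq0.le
  have hGint : ∫⁻ x in P, G x ∂μ ≤ strongConst q * (4 * D * a) ^ q * μ P := by
    calc ∫⁻ x in P, G x ∂μ = ∑' j, ∫⁻ x in P, 𝒢.maxFrom k (v j) x ^ q ∂μ :=
          lintegral_tsum fun j => ((𝒢.measurable_maxFrom k (v j)).pow_const q).aemeasurable
      _ ≤ ∑' j, strongConst q * ∫⁻ x in P, v j x ^ q ∂μ :=
          ENNReal.tsum_le_tsum fun j => hPs.lintegral_maxFrom_rpow_le (hvm j) hq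
      _ = strongConst q * ∫⁻ x in P, ∑' j, v j x ^ q ∂μ := by
          rw [ENNReal.tsum_mul_left, lintegral_tsum fun j => ((hvm j).pow_const q).aemeasurable]
      _ ≤ strongConst q * ∫⁻ _ in P, (4 * D * a) ^ q ∂μ := by
          gcongr 1
          exact setLIntegral_mono' hPs.measurableSet hvle
      _ = _ := by rw [setLIntegral_const, ← mul_assoc]
  set θ := halfConst q D * a ^ q with hθ
  -- The factor 4 in `halfConst` makes Chebyshev's inequality give a quarter of P, the other quarter
  -- being Ω.
  have hθ4 : θ = 4 * (strongConst q * (4 * D * a) ^ q) := by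
    rw [hθ, halfConst, ENNReal.mul_rpow_of_nonneg _ a hq0.le]; ring
  have hθ0 : θ ≠ 0 := by
    have hq0' : ¬ q < 0 := by linarith
    refine mul_ne_zero (halfConst_ne_zero hq hD1) ?_
    simp [ENNReal.rpow_eq_zero_iff, ha0, hq0']
  have hθt : θ ≠ ∞ :=
    ENNReal.mul_ne_top (halfConst_ne_top hq hD) (ENNReal.rpow_ne_top_of_nonneg hq0.le hat)
  have hmarkov : μ (P ∩ {x | θ ≤ G x}) ≤ 4⁻¹ * μ P := by
    have h1 := mul_meas_ge_le_lintegral (μ := μ.restrict P) hGm θ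
    rw [Measure.restrict_apply (measurableSet_le measurable_const hGm), Set.inter_comm] at h1
    rw [← ENNReal.mul_le_mul_iff_right hθ0 hθt]
    calc θ * μ (P ∩ {x | θ ≤ G x}) ≤ strongConst q * (4 * D * a) ^ q * μ P := h1.trans hGint
      _ = (4⁻¹ * 4) * (strongConst q * (4 * D * a) ^ q * μ P) := by
          rw [ENNReal.inv_mul_cancel (by norm_num) (by norm_num), one_mul]
      _ = θ * (4⁻¹ * μ P) := by rw [hθ4]; ring
  have hsub : P ∩ {x | θ < 𝒢.vecMaxBetween q g k N x} ⊆ (P ∩ Ω) ∪ (P ∩ {x | θ ≤ G x}) := by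
    rintro x ⟨hxP, hx⟩
    by_cases hxΩ : x ∈ Ω
    · exact Or.inl ⟨hxP, hxΩ⟩
    · exact Or.inr ⟨hxP, hx.le.trans (hFG x hxΩ)⟩
  calc μ (P ∩ {x | θ < 𝒢.vecMaxBetween q g k N x}) ≤ 4⁻¹ * μ P + 4⁻¹ * μ P :=
        (measure_mono hsub).trans ((measure_union_le _ _).trans (add_le_add hΩm hmarkov))
    _ = 2⁻¹ * μ P := by
        rw [← add_mul]
        congr 1
        rw [← ENNReal.toReal_eq_toReal_iff' (by simp) (by simp), ENNReal.toReal_add (by simp) (by simp)]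
        norm_num

/-- Let N tend to infinity along increasing level sets. The averages 0 and ∞, excluded before in
order to divide, are trivial: the level set is empty. -/
lemma measure_lt_vecMaxFrom_le_half [SFinite μ] {q : ℝ} (hq : 1 < q) (hD1 : 1 ≤ D) (hD : D ≠ ∞)
    {g : ℕ → X → ℝ≥0∞} (hg : ∀ j, Measurable (g j)) (k : ℕ) (x₀ : X) :
    μ (𝒢.cell k x₀ ∩ {x | halfConst q D * 𝒢.avg k (lq q g) x₀ ^ q < 𝒢.vecMaxFrom q g k x}) ≤
      2⁻¹ * μ (𝒢.cell k x₀) := by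
  have hq0 : 0 < q := by linarith
  set θ := halfConst q D * 𝒢.avg k (lq q g) x₀ ^ q with hθ
  rcases eq_or_ne (𝒢.avg k (lq q g) x₀) ∞ with hat | hat
  · have : θ = ∞ := by
      rw [hθ, hat, ENNReal.top_rpow_of_pos hq0, ENNReal.mul_top (halfConst_ne_zero hq hD1)]
    simp [this]
  rcases eq_or_ne (𝒢.avg k (lq q g) x₀) 0 with ha0 | ha0
  · have hz : ∀ x ∈ 𝒢.cell k x₀, 𝒢.vecMaxFrom q g k x = 0 := by
      intro x hx
      have havg : ∀ i, k ≤ i → ∀ j, 𝒢.avg i (g j) x = 0 := fun i hi j => by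
        refine le_antisymm ((𝒢.avg_le_avg_lq hq hg i j x).trans_eq ?_) zero_le
        have h0 : ∫⁻ y in 𝒢.cell k x₀, lq q g y ∂μ = 0 := by
          rw [← 𝒢.avg_mul_measure, ha0, zero_mul]
        have h1 : ∫⁻ y in 𝒢.cell i x, lq q g y ∂μ = 0 := by
          refine le_antisymm ((lintegral_mono_set ?_).trans_eq h0) zero_le
          rw [← 𝒢.cell_eq hx]; exact 𝒢.cell_anti x hi
        rw [avg, h1, ENNReal.zero_div]
      have hmax : ∀ j, 𝒢.maxFrom k (g j) x = 0 := fun j =>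
        le_antisymm (iSup₂_le fun i hi => (havg i hi j).le) zero_le
      simp [vecMaxFrom, hmax, ENNReal.zero_rpow_of_pos hq0]
    have : 𝒢.cell k x₀ ∩ {x | θ < 𝒢.vecMaxFrom q g k x} = ∅ := by
      rw [Set.eq_empty_iff_forall_notMem]
      rintro x ⟨hx, hx'⟩
      rw [Set.mem_ofPred_eq, hz x hx] at hx'
      exact not_lt_zero hx'
    simp [this]
  have hsub : 𝒢.cell k x₀ ∩ {x | θ < 𝒢.vecMaxFrom q g k x} ⊆
      ⋃ N, 𝒢.cell k x₀ ∩ {x | θ < 𝒢.vecMaxBetween q g k N x} := by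
    rintro x ⟨hxP, hx⟩
    by_contra hcon
    simp only [Set.mem_iUnion, not_exists] at hcon
    exact not_le.2 hx (𝒢.vecMaxFrom_le hq0 fun N => not_lt.1 fun hN => hcon N ⟨hxP, hN⟩)
  have hmono : Monotone fun N => 𝒢.cell k x₀ ∩ {x | θ < 𝒢.vecMaxBetween q g k N x} :=
    fun N N' hN x hx => ⟨hx.1, lt_of_lt_of_le hx.2 (𝒢.vecMaxBetween_mono hq0 g k x hN)⟩
  refine (measure_mono hsub).trans ?_
  rw [hmono.measure_iUnion]
  exact iSup_le fun N => 𝒢.measure_lt_vecMaxBetween_le hq hD1 hD hg k N x₀ ha0 hat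

/-! ### Iteration of the half estimate -/

/-- Exponential decay of the level sets of the vector-valued maximal function relative to any
majorant of the averages of the `ℓ^q` norm. -/
lemma measure_lt_vecMaxFrom_le [SFinite μ] {q : ℝ} (hq : 1 < q) (hD1 : 1 ≤ D) (hD : D ≠ ∞)
    {g : ℕ → X → ℝ≥0∞} (hg : ∀ j, Measurable (g j)) {H : X → ℝ≥0∞}
    (hH : ∀ i x, 𝒢.avg i (lq q g) x ≤ H x) (m k : ℕ) (x₀ : X) :
    μ ({x | m * halfConst q D * H x ^ q < 𝒢.vecMaxFrom q g k x} ∩ 𝒢.cell k x₀) ≤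
      2⁻¹ ^ m * μ (𝒢.cell k x₀) := by
  have hq0 : 0 < q := by linarith
  induction m generalizing k x₀ with
  | zero => simpa using measure_mono Set.inter_subset_right
  | succ m ih =>
    set P := 𝒢.cell k x₀
    set θ := halfConst q D * 𝒢.avg k (lq q g) x₀ ^ q with hθ
    set p : ℕ → Set X := fun l => {x | θ < 𝒢.vecMaxBetween q g k l x} with hp
    have hps : ∀ l, 𝒢.Saturated l (p l) := 𝒢.saturated_lt_vecMaxBetween q g k θ
    have hT : ∀ i, 𝒢.Saturated i (P ∩ firstHit p k i) :=
      saturated_inter_firstHit hps (𝒢.saturated_cell k x₀)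
    have hd : Pairwise (Function.onFun Disjoint fun i => P ∩ firstHit p k i) := fun i j hij =>
      (pairwise_disjoint_firstHit p k hij).mono Set.inter_subset_right Set.inter_subset_right
    have hsub : {x | ((m + 1 : ℕ) : ℝ≥0∞) * halfConst q D * H x ^ q < 𝒢.vecMaxFrom q g k x} ∩ P ⊆
        ⋃ i, {x | m * halfConst q D * H x ^ q < 𝒢.vecMaxFrom q g i x} ∩ (P ∩ firstHit p k i) := by
      rintro x ⟨hx, hxP⟩
      rw [Set.mem_ofPred_eq, Nat.cast_add, Nat.cast_one, add_mul, add_mul, one_mul] at hx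
      have hθH : θ ≤ halfConst q D * H x ^ q := by
        rw [hθ, ← 𝒢.avg_eq_of_mem hxP]
        gcongr
        exact hH k x
      have hex : ∃ N, θ < 𝒢.vecMaxBetween q g k N x := by
        by_contra! hcon
        exact not_le.2 hx ((𝒢.vecMaxFrom_le hq0 hcon).trans (hθH.trans le_add_self))
      obtain ⟨N, hN⟩ := hex
      -- `firstHit` only sees levels from k on.
      have hN' : x ∈ p (max k N) :=
        lt_of_lt_of_le hN (𝒢.vecMaxBetween_mono hq0 g k x (le_max_right k N))
      obtain ⟨i, -, hi⟩ := exists_mem_firstHit (le_max_left k N) hN'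
      refine Set.mem_iUnion.2 ⟨i, ?_, hxP, hi⟩
      -- If i = k, nothing precedes the stopping level. Otherwise levels k to i - 1 account for at
      -- most θ, leaving more than m multiples for levels from i on.
      rcases eq_or_lt_of_le hi.1 with rfl | hki
      · exact lt_of_le_of_lt le_self_add hx
      · rw [Set.mem_ofPred_eq]
        by_contra! hcon
        have h1 : 𝒢.vecMaxBetween q g k (i - 1) x ≤ θ :=
          not_lt.1 (hi.2.2 (i - 1) (by omega) (by omega))
        refine not_le.2 hx ((𝒢.vecMaxFrom_le_add hq0 g k i x).trans ?_)
        rw [add_comm]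
        exact add_le_add hcon (h1.trans hθH)
    calc _ ≤ ∑' i, μ ({x | m * halfConst q D * H x ^ q < 𝒢.vecMaxFrom q g i x} ∩
            (P ∩ firstHit p k i)) := (measure_mono hsub).trans (measure_iUnion_le _)
      _ ≤ ∑' i, 2⁻¹ ^ m * μ (P ∩ firstHit p k i) :=
          ENNReal.tsum_le_tsum fun i => (hT i).measure_inter_le _ fun x => ih i x
      _ = 2⁻¹ ^ m * μ (⋃ i, P ∩ firstHit p k i) := by
          rw [ENNReal.tsum_mul_left, measure_iUnion hd fun i => (hT i).measurableSet]
      _ ≤ 2⁻¹ ^ m * (2⁻¹ * μ P) := by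
          gcongr
          -- The stopping cells lie where F_k exceeds θ; this yields the extra factor 1/2.
          refine (measure_mono ?_).trans (𝒢.measure_lt_vecMaxFrom_le_half hq hD1 hD hg k x₀)
          refine Set.iUnion_subset fun i x hx => ⟨hx.1, (?_ : θ < _)⟩
          refine lt_of_lt_of_le hx.2.2.1 ?_
          refine ENNReal.tsum_le_tsum fun j => ENNReal.rpow_le_rpow ?_ hq0.le
          rw [maxFrom_eq_iSup]
          exact le_iSup (fun N => 𝒢.maxBetween k N (g j) x) i
      _ = 2⁻¹ ^ (m + 1) * μ P := by rw [pow_succ, mul_assoc]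

end NestedPartition

/-! ### Dyadic grids and the one-third trick -/

variable {n : ℕ}

/-- The index of the dyadic cube of side `L / 2 ^ k` of the grid with origin `a` containing `x`. -/
def gridIndex (a : Fin n → ℝ) (L : ℝ) (k : ℕ) (x : Fin n → ℝ) : Fin n → ℤ :=
  fun i => ⌊2 ^ k * ((x i - a i) / L)⌋

/-- The corner of the dyadic cube containing `x`. -/
def gridCorner (a : Fin n → ℝ) (L : ℝ) (k : ℕ) (x : Fin n → ℝ) : Fin n → ℝ :=
  fun i => a i + gridIndex a L k x i * (L / 2 ^ k)

lemma setOf_gridIndex_eq (a : Fin n → ℝ) {L : ℝ} (hL : 0 < L) (k : ℕ) (x : Fin n → ℝ) :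
    {y | gridIndex a L k y = gridIndex a L k x} = Set.univ.pi fun i =>
      Set.Ico (gridCorner a L k x i) (gridCorner a L k x i + L / 2 ^ k) := by
  ext y
  simp only [Set.mem_ofPred_eq, Set.mem_univ_pi, funext_iff, Set.mem_Ico]
  refine forall_congr' fun i => ?_
  have h2 : (0 : ℝ) < 2 ^ k := by positivity
  have hδ : 0 < L / 2 ^ k := by positivity
  have hz : 2 ^ k * ((y i - a i) / L) = (y i - a i) / (L / 2 ^ k) := by field_simp
  conv_lhs => rw [gridIndex, Int.floor_eq_iff, hz, le_div_iff₀ hδ, div_lt_iff₀ hδ]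
  rw [gridCorner]
  constructor <;> rintro ⟨h, h'⟩ <;> constructor <;> linarith

lemma volume_setOf_gridIndex_eq (a : Fin n → ℝ) {L : ℝ} (hL : 0 < L) (k : ℕ) (x : Fin n → ℝ) :
    volume {y | gridIndex a L k y = gridIndex a L k x} = ENNReal.ofReal (L / 2 ^ k) ^ n := by
  rw [setOf_gridIndex_eq a hL, Real.volume_pi_Ico]
  simp

/-- The dyadic grid with origin `a` and top side length `L`. -/
def grid (a : Fin n → ℝ) {L : ℝ} (hL : 0 < L) :
    NestedPartition (volume : Measure (Fin n → ℝ)) (2 ^ n) where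
  cell k x := {y | gridIndex a L k y = gridIndex a L k x}
  mem_cell _ _ := rfl
  cell_eq {k x y} h := by
    rw [Set.mem_ofPred_eq] at h
    rw [h]
  cell_succ_subset k x y hy := by
    rw [Set.mem_ofPred_eq] at hy ⊢
    funext i
    have hfl : ∀ z : ℝ, ⌊2 ^ k * z⌋ = ⌊2 ^ (k + 1) * z⌋ / 2 := fun z => by
      have h1 := Int.floor_le (2 ^ (k + 1) * z)
      have h2 := Int.lt_floor_add_one (2 ^ (k + 1) * z)
      set m := ⌊2 ^ (k + 1) * z⌋
      have h3 : m = 2 * (m / 2) ∨ m = 2 * (m / 2) + 1 := by omega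
      rw [Int.floor_eq_iff]
      rw [pow_succ] at h1 h2
      have h4 : (m : ℝ) = 2 * ((m / 2 : ℤ) : ℝ) ∨ (m : ℝ) = 2 * ((m / 2 : ℤ) : ℝ) + 1 := by
        exact_mod_cast h3
      rcases h4 with h | h <;> constructor <;> linarith
    have hi := congrFun hy i
    simp only [gridIndex] at hi ⊢
    rw [hfl, hfl ((x i - a i) / L), hi]
  measurableSet_cell k x := by
    rw [setOf_gridIndex_eq a hL]
    exact MeasurableSet.univ_pi fun i => measurableSet_Ico
  countable_range_cell k := by
    have : Set.range (fun x => {y | gridIndex a L k y = gridIndex a L k x}) ⊆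
        Set.range fun m : Fin n → ℤ => {y | gridIndex a L k y = m} := by
      rintro _ ⟨x, rfl⟩
      exact ⟨gridIndex a L k x, rfl⟩
    exact (Set.countable_range _).mono this
  measure_cell_ne_zero k x := by
    rw [volume_setOf_gridIndex_eq a hL]
    have : 0 < L / 2 ^ k := by positivity
    exact pow_ne_zero _ (by simpa using this)
  measure_cell_ne_top k x := by
    rw [volume_setOf_gridIndex_eq a hL]
    exact ENNReal.pow_ne_top ENNReal.ofReal_ne_top
  measure_cell_le k x := by
    rw [volume_setOf_gridIndex_eq a hL, volume_setOf_gridIndex_eq a hL, ← mul_pow]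
    gcongr
    rw [← ENNReal.ofReal_ofNat 2, ← ENNReal.ofReal_mul (by norm_num)]
    apply ENNReal.ofReal_le_ofReal
    rw [pow_succ]
    field_simp
    exact le_rfl

lemma volume_grid_cell (a : Fin n → ℝ) {L : ℝ} (hL : 0 < L) (k : ℕ) (x : Fin n → ℝ) :
    volume ((grid a hL).cell k x) = ENNReal.ofReal (L / 2 ^ k) ^ n :=
  volume_setOf_gridIndex_eq a hL k x

lemma volume_Icc_add (c : Fin n → ℝ) (r : ℝ) :
    volume (Set.Icc c fun i => c i + r) = ENNReal.ofReal r ^ n := by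
  simp [Real.volume_Icc_pi]

lemma avg_grid_le_maximal {ε : Type*} [ENorm ε] (f : (Fin n → ℝ) → ε) (a : Fin n → ℝ) {L : ℝ}
    (hL : 0 < L) (k : ℕ) (x : Fin n → ℝ) :
    (grid a hL).avg k (fun y => ‖f y‖ₑ) x ≤ maximal f x := by
  set Q := Set.Icc (gridCorner a L k x) fun i => gridCorner a L k x i + L / 2 ^ k with hQ
  have hsub : (grid a hL).cell k x ⊆ Q := by
    change {y | gridIndex a L k y = gridIndex a L k x} ⊆ Q
    rw [setOf_gridIndex_eq a hL, hQ, ← Set.pi_univ_Icc]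
    exact Set.pi_mono fun i _ => Set.Ico_subset_Icc_self
  have hcube : IsCube Q := ⟨_, L / 2 ^ k, by positivity, rfl⟩
  refine le_iSup_of_le Q (le_iSup₂_of_le hcube (hsub ((grid a hL).mem_cell k x)) ?_)
  rw [NestedPartition.avg, volume_grid_cell, hQ, volume_Icc_add]
  exact ENNReal.div_le_div_right (lintegral_mono_set hsub) _

/-- The one-third trick: an interval of length less than `1 / 3` of the mesh lies in an interval of
the standard grid or of its translate by one third of the top mesh. -/
lemma floor_eq_or_floor_eq (k : ℕ) (z ρ : ℝ) (hρ : ρ < 1 / 3) :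
    ⌊z⌋ = ⌊z + ρ⌋ ∨ ⌊z - 2 ^ k / 3⌋ = ⌊z - 2 ^ k / 3 + ρ⌋ ∨ ρ < 0 := by
  by_contra! hcon
  obtain ⟨h1, h2, h3⟩ := hcon
  have key : ∀ w : ℝ, ⌊w⌋ ≠ ⌊w + ρ⌋ → ∃ m : ℤ, w < m ∧ (m : ℝ) ≤ w + ρ := by
    intro w hw
    refine ⟨⌊w⌋ + 1, by push_cast; exact Int.lt_floor_add_one w, ?_⟩
    have hlt : ⌊w⌋ < ⌊w + ρ⌋ := lt_of_le_of_ne (Int.floor_mono (by linarith)) hw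
    exact Int.le_floor.1 hlt
  obtain ⟨m, hm1, hm2⟩ := key _ h1
  obtain ⟨l, hl1, hl2⟩ := key _ h2
  -- If both grids cut the interval, the integer 3(m - l) - 2^k has absolute value below 3ρ < 1, so
  -- it vanishes; but 3 does not divide 2^k.
  have h4 : ((3 * (m - l) - 2 ^ k : ℤ) : ℝ) < 1 := by push_cast; linarith
  have h5 : (-1 : ℝ) < ((3 * (m - l) - 2 ^ k : ℤ) : ℝ) := by push_cast; linarith
  have h6 : 3 * (m - l) - 2 ^ k < 1 := by exact_mod_cast h4
  have h7 : -1 < 3 * (m - l) - 2 ^ k := by exact_mod_cast h5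
  have h8 : (3 : ℤ) ∣ 2 ^ k := ⟨m - l, by linarith⟩
  have h9 := Int.prime_three.dvd_of_dvd_pow h8
  norm_num at h9

/-- The origins of the `2 ^ n` translated grids with top side length `3 * l` associated with the
cube with corner `b` and side `l`. -/
def gridOrigin (b : Fin n → ℝ) (l : ℝ) (s : Fin n → Bool) : Fin n → ℝ :=
  fun i => b i - 3 * l / 2 + if s i then l else 0

lemma subset_grid_cell (b : Fin n → ℝ) {l : ℝ} (hL : 0 < 3 * l) (s : Fin n → Bool) :
    Set.Icc b (fun i => b i + l) ⊆ (grid (gridOrigin b l s) hL).cell 0 b := by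
  -- Each coordinate of the origin lies 3l/2 or l/2 below b, so an interval of length l starting at
  -- b fits inside the top interval of length 3l.
  have hz : ∀ y ∈ Set.Icc b (fun i => b i + l), ∀ i, gridIndex (gridOrigin b l s) (3 * l) 0 y i = 0 := by
    intro y hy i
    have h1 := hy.1 i
    have h2 := hy.2 i
    simp only at h2
    rw [gridIndex, pow_zero, one_mul, Int.floor_eq_iff, gridOrigin]
    rw [le_div_iff₀ hL, div_lt_iff₀ hL]
    split_ifs <;> push_cast <;> constructor <;> linarith
  intro y hy
  funext i
  rw [hz y hy i, hz b ⟨le_rfl, fun i => by simp only; linarith⟩ i]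

/-- Every cube of side less than `l` lies in a cell of comparable size of one of the grids. -/
lemma exists_subset_grid_cell (b : Fin n → ℝ) {l : ℝ} (hL : 0 < 3 * l) (c : Fin n → ℝ) {r : ℝ}
    (hr : 0 < r) (hrl : r < l) {x : Fin n → ℝ} (hx : x ∈ Set.Icc c fun i => c i + r) :
    ∃ (s : Fin n → Bool) (k : ℕ), 3 * l / 2 ^ k ≤ 6 * r ∧
      Set.Icc c (fun i => c i + r) ⊆ (grid (gridOrigin b l s) hL).cell k x := by
  have hl : 0 < l := by linarith
  obtain ⟨k, hk1, hk2⟩ : ∃ k : ℕ, (1 / 2 : ℝ) ^ (k + 1) ≤ r / l ∧ r / l < (1 / 2) ^ k := by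
    obtain ⟨k, hk1, hk2⟩ := exists_nat_pow_near (x := l / r) (y := (2 : ℝ))
      ((one_le_div hr).2 hrl.le) one_lt_two
    -- Equality 2^k = l/r must move to the previous exponent: the strict bound r/l < 2^{-k} is what
    -- gives ρ < 1/3.
    rcases eq_or_lt_of_le hk1 with h | h
    · obtain ⟨k, rfl⟩ : ∃ k', k = k' + 1 := by
        refine ⟨k - 1, ?_⟩
        rcases Nat.eq_zero_or_pos k with rfl | hk
        · rw [pow_zero, eq_div_iff hr.ne'] at h; linarith
        · omega
      refine ⟨k, ?_, ?_⟩
      · rw [one_div, inv_pow, h, inv_div]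
      · have : r / l = (1 / 2) ^ (k + 1) := by rw [one_div, inv_pow, h, inv_div]
        rw [this]
        exact pow_lt_pow_right_of_lt_one₀ (by norm_num) (by norm_num) (by omega)
    · refine ⟨k, ?_, ?_⟩
      · rw [one_div, inv_pow, ← inv_div l r]
        exact inv_anti₀ (by positivity) hk2.le
      · rw [one_div, inv_pow, ← inv_div l r]
        exact inv_strictAnti₀ (by positivity) h
  have h2k : (0 : ℝ) < 2 ^ k := by positivity
  set ρ : ℝ := 2 ^ k * (r / (3 * l)) with hρ
  have hρ0 : 0 ≤ ρ := by positivity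
  have hρ3 : ρ < 1 / 3 := by
    have : 2 ^ k * (r / l) < 1 := by
      calc 2 ^ k * (r / l) < 2 ^ k * (1 / 2) ^ k := by gcongr
        _ = 1 := by rw [← mul_pow]; norm_num
    have h3 : ρ = 2 ^ k * (r / l) / 3 := by rw [hρ]; field_simp
    linarith
  set z : Fin n → ℝ := fun i => 2 ^ k * ((c i - (b i - 3 * l / 2)) / (3 * l)) with hz
  have hch : ∀ i, ∃ t : Bool, ⌊z i - (if t then 2 ^ k / 3 else 0)⌋ =
      ⌊z i - (if t then 2 ^ k / 3 else 0) + ρ⌋ := by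
    intro i
    rcases floor_eq_or_floor_eq k (z i) ρ hρ3 with h | h | h
    · exact ⟨false, by simpa using h⟩
    · exact ⟨true, by simpa using h⟩
    · linarith
  choose s hs using hch
  refine ⟨s, k, ?_, ?_⟩
  · rw [div_le_iff₀ h2k]
    rw [one_div, inv_pow, pow_succ, ← one_div, div_le_div_iff₀ (by positivity) hl] at hk1
    linarith
  · have hidx : ∀ y ∈ Set.Icc c (fun i => c i + r), ∀ i,
        gridIndex (gridOrigin b l s) (3 * l) k y i =
          ⌊z i - (if s i then 2 ^ k / 3 else 0)⌋ := by
      intro y hy i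
      have h1 := hy.1 i
      have h2 := hy.2 i
      simp only at h2
      have hw : ∀ w : ℝ, 2 ^ k * ((w - gridOrigin b l s i) / (3 * l)) =
          z i - (if s i then 2 ^ k / 3 else 0) + 2 ^ k * ((w - c i) / (3 * l)) := by
        intro w
        simp only [hz, gridOrigin]
        split_ifs <;> field_simp <;> ring
      rw [gridIndex, hw]
      refine le_antisymm ?_ ?_
      · rw [hs i]
        refine Int.floor_mono (add_le_add_right ?_ _)
        rw [hρ]
        gcongr
        linarith
      · refine Int.floor_mono (le_add_of_nonneg_right ?_)
        have : 0 ≤ y i - c i := by linarith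
        positivity
    intro y hy
    funext i
    rw [hidx y hy i, hidx x hx i]

/-- On a cube containing the support of `f`, the maximal function of `f` is controlled by the
maximal functions of the translated grids. -/
lemma exists_maximal_le {ε : Type*} [ENorm ε] (b : Fin n → ℝ) {l : ℝ} (hL : 0 < 3 * l)
    {f : (Fin n → ℝ) → ε} (hf : ∀ y ∉ Set.Icc b (fun i => b i + l), ‖f y‖ₑ = 0)
    {x : Fin n → ℝ} (hx : x ∈ Set.Icc b fun i => b i + l) :
    maximal f x ≤ 6 ^ n *
      ⨆ s : Fin n → Bool, (grid (gridOrigin b l s) hL).maxFrom 0 (fun y => ‖f y‖ₑ) x := by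
  have hl : 0 < l := by linarith
  refine iSup_le fun P => iSup₂_le ?_
  rintro ⟨c, r, hr, rfl⟩ hxP
  have key : ∀ (s : Fin n → Bool) (k : ℕ), 3 * l / 2 ^ k ≤ 6 * r →
      ∫⁻ y in Set.Icc c (fun i => c i + r), ‖f y‖ₑ ≤
        ∫⁻ y in (grid (gridOrigin b l s) hL).cell k x, ‖f y‖ₑ →
      (∫⁻ y in Set.Icc c (fun i => c i + r), ‖f y‖ₑ) / volume (Set.Icc c fun i => c i + r) ≤
        6 ^ n * ⨆ s : Fin n → Bool,
          (grid (gridOrigin b l s) hL).maxFrom 0 (fun y => ‖f y‖ₑ) x := by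
    intro s k hk hint
    have hr0 : ENNReal.ofReal r ≠ 0 := by simpa using hr
    rw [volume_Icc_add, ENNReal.div_le_iff (pow_ne_zero _ hr0)
      (ENNReal.pow_ne_top ENNReal.ofReal_ne_top)]
    calc ∫⁻ y in Set.Icc c (fun i => c i + r), ‖f y‖ₑ
        ≤ (grid (gridOrigin b l s) hL).avg k (fun y => ‖f y‖ₑ) x *
            ENNReal.ofReal (3 * l / 2 ^ k) ^ n := by
          rw [← volume_grid_cell (gridOrigin b l s) hL k x, NestedPartition.avg_mul_measure]
          exact hint
      _ ≤ (⨆ s : Fin n → Bool, (grid (gridOrigin b l s) hL).maxFrom 0 (fun y => ‖f y‖ₑ) x) *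
            ENNReal.ofReal (6 * r) ^ n := by
          gcongr
          exact le_iSup_of_le s (le_iSup₂_of_le k k.zero_le le_rfl)
      _ = _ := by
          rw [ENNReal.ofReal_mul (by norm_num), mul_pow, ENNReal.ofReal_ofNat]; ring
  rcases lt_or_ge r l with hrl | hlr
  · obtain ⟨s, k, hk, hsub⟩ := exists_subset_grid_cell b hL c hr hrl hxP
    exact key s k hk (lintegral_mono_set hsub)
  -- When r ≥ l, the top cell of any of the grids contains the support and has side 3l ≤ 6r.
  · refine key (fun _ => false) 0 (by linarith) ?_
    have hbx := subset_grid_cell b hL fun _ => false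
    rw [(grid _ hL).cell_eq (hbx hx)]
    calc ∫⁻ y in Set.Icc c (fun i => c i + r), ‖f y‖ₑ ≤ ∫⁻ y, ‖f y‖ₑ := setLIntegral_le_lintegral _ _
      _ = ∫⁻ y in Set.Icc b (fun i => b i + l), ‖f y‖ₑ := by
          rw [← lintegral_indicator measurableSet_Icc]
          refine lintegral_congr fun y => ?_
          by_cases hy : y ∈ Set.Icc b (fun i => b i + l)
          · rw [Set.indicator_of_mem hy]
          · rw [Set.indicator_of_notMem hy, hf y hy]
      _ ≤ _ := lintegral_mono_set hbx

/-! ### From the grids to cubes -/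

namespace NestedPartition

variable {X : Type*} [MeasurableSpace X] {μ : Measure X} {D : ℝ≥0∞} (𝒢 : NestedPartition μ D)

lemma avg_congr_ae {u v : X → ℝ≥0∞} (h : u =ᵐ[μ] v) (k : ℕ) (x : X) :
    𝒢.avg k u x = 𝒢.avg k v x := by
  rw [avg, avg, lintegral_congr_ae (ae_restrict_of_ae h)]

lemma maxFrom_congr_ae {u v : X → ℝ≥0∞} (h : u =ᵐ[μ] v) (k : ℕ) (x : X) :
    𝒢.maxFrom k u x = 𝒢.maxFrom k v x :=
  iSup_congr fun i => iSup_congr fun _ => 𝒢.avg_congr_ae h i x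

end NestedPartition

open NestedPartition

/-- If the vector-valued maximal function is large at a point of a cube containing the supports,
then so is one of its dyadic counterparts. -/
lemma vectorMaximal_rpow_le {q : ℝ} (hq : 0 < q) (b : Fin n → ℝ) {l : ℝ} (hL : 0 < 3 * l)
    {f : ℕ → (Fin n → ℝ) → ℂ} (hf : ∀ j, Function.support (f j) ⊆ Set.Icc b fun i => b i + l)
    {x : Fin n → ℝ} (hx : x ∈ Set.Icc b fun i => b i + l) :
    vectorMaximal q f x ^ q ≤ (6 ^ n) ^ q * ∑ s : Fin n → Bool,
      (grid (gridOrigin b l s) hL).vecMaxFrom q (fun j y => ‖f j y‖ₑ) 0 x := by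
  rw [vectorMaximal, ← ENNReal.rpow_mul, one_div_mul_cancel hq.ne', ENNReal.rpow_one]
  simp_rw [vecMaxFrom]
  rw [← Summable.tsum_finsetSum fun _ _ => ENNReal.summable, ← ENNReal.tsum_mul_left]
  refine ENNReal.tsum_le_tsum fun j => ?_
  have h0 : ∀ y ∉ Set.Icc b (fun i => b i + l), ‖f j y‖ₑ = 0 := fun y hy => by
    rw [enorm_eq_zero]
    by_contra hne
    exact hy (hf j hne)
  refine (ENNReal.rpow_le_rpow (exists_maximal_le b hL h0 hx) hq.le).trans ?_
  rw [ENNReal.mul_rpow_of_nonneg _ _ hq.le, iSup_rpow _ hq]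
  gcongr
  exact iSup_le fun s => Finset.single_le_sum
    (f := fun s => (grid (gridOrigin b l s) hL).maxFrom 0 (fun y => ‖f j y‖ₑ) x ^ q)
    (fun _ _ => zero_le) (Finset.mem_univ s)

lemma measure_lt_vectorMaximal_le {q : ℝ} (hq : 1 < q) {Q : Set (Fin n → ℝ)} (hQ : IsCube Q)
    {f : ℕ → (Fin n → ℝ) → ℂ} (hfm : ∀ j, AEMeasurable (f j) volume)
    (hf : ∀ j, Function.support (f j) ⊆ Q) {t : ℝ} (m : ℕ)
    (hm : (6 ^ n) ^ q * 2 ^ n * halfConst q (2 ^ n) * m ≤ ENNReal.ofReal t ^ q) :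
    volume {x ∈ Q | ENNReal.ofReal t * maximal (lqNorm q f) x < vectorMaximal q f x} ≤
      6 ^ n * 2⁻¹ ^ m * volume Q := by
  have hq0 : 0 < q := by linarith
  obtain ⟨b, l, hl, rfl⟩ := hQ
  have hL : 0 < 3 * l := by linarith
  -- Measurable representatives; all averages, hence the dyadic maximal functions, are unchanged at
  -- every point.
  set g : ℕ → (Fin n → ℝ) → ℝ≥0∞ := fun j => (hfm j).enorm.mk with hg
  have hgm : ∀ j, Measurable (g j) := fun j => (hfm j).enorm.measurable_mk
  have hgf : ∀ j, (fun y => ‖f j y‖ₑ) =ᵐ[volume] g j := fun j => (hfm j).enorm.ae_eq_mk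
  have hlq : lq q g =ᵐ[volume] lqNorm q f := by
    filter_upwards [ae_all_iff.2 hgf] with y hy
    simp only [lq, lqNorm, hy]
  set H := maximal (lqNorm q f) with hH
  have hHle : ∀ (s : Fin n → Bool) (i : ℕ) (x : Fin n → ℝ),
      (grid (gridOrigin b l s) hL).avg i (lq q g) x ≤ H x := fun s i x => by
    rw [NestedPartition.avg_congr_ae _ hlq]
    exact avg_grid_le_maximal (lqNorm q f) _ hL i x
  set Λ := halfConst q (2 ^ n) with hΛ
  have hsub : {x ∈ Set.Icc b (fun i => b i + l) | ENNReal.ofReal t * H x < vectorMaximal q f x} ⊆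
      ⋃ s : Fin n → Bool, {x | m * Λ * H x ^ q <
        (grid (gridOrigin b l s) hL).vecMaxFrom q g 0 x} ∩
          (grid (gridOrigin b l s) hL).cell 0 b := by
    rintro x ⟨hxQ, hx⟩
    by_contra hcon
    have hle : ∀ s : Fin n → Bool,
        (grid (gridOrigin b l s) hL).vecMaxFrom q (fun j y => ‖f j y‖ₑ) 0 x ≤ m * Λ * H x ^ q := by
      intro s
      by_contra! hlt
      refine hcon (Set.mem_iUnion.2 ⟨s, ?_, subset_grid_cell b hL s hxQ⟩)
      simpa only [Set.mem_ofPred_eq, vecMaxFrom, NestedPartition.maxFrom_congr_ae _ (hgf _)] using hlt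
    rw [← ENNReal.rpow_lt_rpow_iff hq0] at hx
    refine not_le.2 hx ((vectorMaximal_rpow_le hq0 b hL hf hxQ).trans ?_)
    calc (6 ^ n) ^ q * ∑ s : Fin n → Bool,
          (grid (gridOrigin b l s) hL).vecMaxFrom q (fun j y => ‖f j y‖ₑ) 0 x
        ≤ (6 ^ n) ^ q * ∑ _s : Fin n → Bool, m * Λ * H x ^ q := by
          gcongr
          exact hle _
      _ = (6 ^ n) ^ q * 2 ^ n * Λ * m * H x ^ q := by simp; ring
      _ ≤ ENNReal.ofReal t ^ q * H x ^ q := by gcongr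
      _ = (ENNReal.ofReal t * H x) ^ q := (ENNReal.mul_rpow_of_nonneg _ _ hq0.le).symm
  calc _ ≤ ∑ s : Fin n → Bool, volume ({x | m * Λ * H x ^ q <
          (grid (gridOrigin b l s) hL).vecMaxFrom q g 0 x} ∩
            (grid (gridOrigin b l s) hL).cell 0 b) :=
        (measure_mono hsub).trans (measure_iUnion_fintype_le _ _)
    _ ≤ ∑ s : Fin n → Bool, 2⁻¹ ^ m * ENNReal.ofReal (3 * l) ^ n := by
        refine Finset.sum_le_sum fun s _ => ?_
        refine (measure_lt_vecMaxFrom_le _ hq (one_le_pow₀ one_le_two)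
          (ENNReal.pow_ne_top ENNReal.ofNat_ne_top) hgm (hHle s) m 0 b).trans_eq ?_
        rw [volume_grid_cell, pow_zero, div_one]
    -- There are 2^n grids, each with a top cell of measure 3^n |Q|.
    _ = (2 * 3) ^ n * 2⁻¹ ^ m * volume (Set.Icc b fun i => b i + l) := by
        rw [volume_Icc_add, ENNReal.ofReal_mul (by norm_num), mul_pow, mul_pow,
          ENNReal.ofReal_ofNat]
        simp
        ring
    _ = _ := by norm_num

end HardyLittlewood

end

/-! ### Choice of the constants -/

theorem theorem2p5 (n : ℕ) (hn : 1 ≤ n) (q : ℝ) (hq : 1 < q) :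
    ∃ α c : ℝ, 0 < α ∧ 0 < c ∧
      ∀ Q : Set (Fin n → ℝ), HardyLittlewood.IsCube Q →
      ∀ f : ℕ → (Fin n → ℝ) → ℂ, (∀ j, AEMeasurable (f j) volume) →
        (∀ j, Function.support (f j) ⊆ Q) →
      ∀ t : ℝ, 0 < t →
        volume {x ∈ Q | ENNReal.ofReal t *
            HardyLittlewood.maximal (HardyLittlewood.lqNorm q f) x
              < HardyLittlewood.vectorMaximal q f x}
          ≤ ENNReal.ofReal (c * Real.exp (-α * t ^ q)) * volume Q := by
  have hq0 : 0 < q := by linarith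
  set C : ℝ≥0∞ := (6 ^ n) ^ q * 2 ^ n * HardyLittlewood.NestedPartition.halfConst q (2 ^ n) with hC
  have hCt : C ≠ ∞ := ENNReal.mul_ne_top (ENNReal.mul_ne_top
    (ENNReal.rpow_ne_top_of_nonneg hq0.le (ENNReal.pow_ne_top ENNReal.ofNat_ne_top))
    (ENNReal.pow_ne_top ENNReal.ofNat_ne_top))
    (HardyLittlewood.NestedPartition.halfConst_ne_top hq (ENNReal.pow_ne_top ENNReal.ofNat_ne_top))
  have hC0 : C ≠ 0 := by
    refine mul_ne_zero (mul_ne_zero ?_ (by simp))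
      (HardyLittlewood.NestedPartition.halfConst_ne_zero hq (one_le_pow₀ one_le_two))
    have hq0' : ¬ q < 0 := by linarith
    simp [ENNReal.rpow_eq_zero_iff, hq0']
  set K := C.toReal with hK
  have hKpos : 0 < K := ENNReal.toReal_pos hC0 hCt
  have hlog : 0 < Real.log 2 := Real.log_pos one_lt_two
  refine ⟨Real.log 2 / K, 2 * 6 ^ n, by positivity, by positivity, ?_⟩
  intro Q hQ f hfm hf t ht
  have htq : 0 ≤ t ^ q / K := by positivity
  -- The largest number of halvings allowed by C m ≤ t^q. Rounding down loses less than one halving,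
  -- hence the factor 2 in c.
  set m := ⌊t ^ q / K⌋₊ with hm
  have hmle : (m : ℝ) ≤ t ^ q / K := Nat.floor_le htq
  have hmlt : t ^ q / K < m + 1 := Nat.lt_floor_add_one _
  refine (HardyLittlewood.measure_lt_vectorMaximal_le hq hQ hfm hf m ?_).trans ?_
  · rw [← hC, ← ENNReal.ofReal_toReal hCt, ← ENNReal.ofReal_natCast,
      ← ENNReal.ofReal_mul hKpos.le, ENNReal.ofReal_rpow_of_pos ht]
    apply ENNReal.ofReal_le_ofReal
    rw [le_div_iff₀ hKpos] at hmle
    linarith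
  · gcongr
    have h6 : (6 : ℝ≥0∞) ^ n * 2⁻¹ ^ m = ENNReal.ofReal (6 ^ n * (1 / 2) ^ m) := by
      rw [ENNReal.ofReal_mul (by positivity), ENNReal.ofReal_pow (by norm_num),
        ENNReal.ofReal_pow (by norm_num), one_div, ENNReal.ofReal_inv_of_pos two_pos,
        ENNReal.ofReal_ofNat, ENNReal.ofReal_ofNat]
    rw [h6]
    apply ENNReal.ofReal_le_ofReal
    have hexp : (1 / 2 : ℝ) ^ m ≤ 2 * Real.exp (-(Real.log 2 / K) * t ^ q) := by
      have h1 : (1 / 2 : ℝ) ^ m = 2 * Real.exp (-(Real.log 2) * (m + 1)) := by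
        rw [Real.exp_mul, Real.exp_neg, Real.exp_log two_pos, ← Nat.cast_add_one,
          Real.rpow_natCast, pow_succ, one_div]
        ring
      rw [h1]
      refine mul_le_mul_of_nonneg_left (Real.exp_le_exp.2 ?_) zero_le_two
      calc -Real.log 2 * (m + 1) ≤ -Real.log 2 * (t ^ q / K) := by nlinarith
        _ = -(Real.log 2 / K) * t ^ q := by ring
    calc (6 : ℝ) ^ n * (1 / 2) ^ m
        ≤ 6 ^ n * (2 * Real.exp (-(Real.log 2 / K) * t ^ q)) := by gcongr
      _ = _ := by ring
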